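/- Let $\mathbb T$ be the unit circle and $\mathbb D$ the open unit disk of $\mathbb C$. For a subarc $I\subseteq\mathbb T$ put $|I|=\frac1{2\pi}\int_I|d\zeta|$ and $f_I=\frac1{2\pi|I|}\int_I f(\zeta)\,|d\zeta|$. For $p\ge 1$ and $\eta\ge 0$ the Campanato space $\mathcal L_{p,\eta}=\mathcal L_{p,\eta}(\mathbb T)$ consists of all complex-valued $f\in L^p(\mathbb T)$ with $$\|f\|_{p,\eta}=\sup_{I\subseteq\mathbb T}\Big(\frac1{|I|^\eta}\int_I|f(\zeta)-f_I|^p\,\frac{|d\zeta|}{2\pi}\Big)^{1/p}<\infty ,$$ the supremum being over all subarcs $I$ of $\mathbb T$ of positive length, and is normed by $\|f\|_p+\|f\|_{p,\eta}$, where $\|f\|_p=\big(\int_{\mathbb T}|f|^p\frac{|d\zeta|}{2\pi}\big)^{1/p}$. The Hardy space $H^p$ consists of the analytic functions $F$ on $\mathbb D$ with $\sup_{0<r<1}\|F(r\,\cdot)\|_p<\infty$; such an $F$ is identified with its boundary function $F(\zeta)=\lim_{r\to1^-}F(r\zeta)$, defined for almost every $\zeta\in\mathbb T$. The analytic Campanato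 space $\mathcal{AL}_{p,\eta}=\mathcal L_{p,\eta}\cap H^p$ consists of the $F\in H^p$ whose boundary function is in $\mathcal L_{p,\eta}$, with the norm $\|\cdot\|_p+\|\cdot\|_{p,\eta}$ of the boundary function. For $f\in L^p(\mathbb T)$ and $z\in\mathbb D$ let $$Sf(z)=\frac1{2\pi}\int_0^{2\pi}\frac{f(e^{i\theta})}{1-ze^{-i\theta}}\,d\theta,\qquad \tilde f(z)=\frac1{2\pi}\int_0^{2\pi}\Im\Big(\frac{e^{i\theta}+z}{e^{i\theta}-z}\Big)f(e^{i\theta})\,d\theta$$ be the Szegő projection and the harmonic conjugate of $f$, and let $\tilde f(e^{i\theta})=\lim_{r\to1^-}\tilde f(re^{i\theta})$. Let $0<\eta<2<1+p<\infty$. Then the Szegő projection $S$ maps $\mathcal L_{p,\eta}$ boundedly onto $\mathcal{AL}_{p,\eta}$: there is a constant $C$, depending only on $p$ and $\eta$, such that for every $f\in\mathcal L_{p,\eta}$ one has $Sf\in\mathcal{AL}_{p,\eta}$ and $\|Sf\|_p+\|Sf\|_{p,\eta}\le C(\|f\|_p+\|f\|_{p,\eta})$, and every $F\in\mathcal{AL}_{p,\eta}$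 equals $Sf$ on $\mathbb D$ for some $f\in\mathcal L_{p,\eta}$. Equivalently, the conjugate operator $f\mapsto\tilde f$ is bounded on $\mathcal L_{p,\eta}$: there is a constant $C$, depending only on $p$ and $\eta$, such that for every $f\in\mathcal L_{p,\eta}$ the limit $\tilde f(e^{i\theta})$ exists for almost every $\theta$, the function $\tilde f$ on $\mathbb T$ is in $\mathcal L_{p,\eta}$, and $\|\tilde f\|_p+\|\tilde f\|_{p,\eta}\le C(\|f\|_p+\|f\|_{p,\eta})$. Both assertions hold. -/

import Mathlib

open MeasureTheory Filter Topology
open scoped ENNReal NNReal ComplexConjugate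

namespace Campanato

noncomputable section

instance fact_two_pi_pos : Fact (0 < 2 * Real.pi) := ⟨Real.two_pi_pos⟩

/-- The unit circle, parametrized by `t ∈ ℝ / 2πℤ`, the class of `t` standing for `e^{it}`. -/
abbrev T : Type := AddCircle (2 * Real.pi)

/-- The normalized arc length measure `|dζ| / 2π` on the circle (total mass one). -/
abbrev σ : Measure T := AddCircle.haarAddCircle

/-- The point `ζ = e^{it}` of the complex plane. -/
def pt (t : T) : ℂ := (AddCircle.toCircle t : ℂ)

theorem pt_coe (t : ℝ) : pt (t : T) = Complex.exp (t * Complex.I) := by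
  simp [pt, AddCircle.toCircle_apply_mk, Circle.coe_exp]

/-- The subarc `{e^{it} : a < t ≤ b}`. Subarcs of the circle are, up to their endpoints,
the sets `arc a b` with `a < b ≤ a + 2π`. -/
def arc (a b : ℝ) : Set T := (fun t : ℝ => (t : T)) '' Set.Ioc a b

/-- The mean of `f` over `I` with respect to arc length. -/
def mean (f : T → ℂ) (I : Set T) : ℂ := ⨍ t in I, f t ∂σ

/-- The Campanato seminorm
`sup_I ( |I|^{-η} ∫_I |f - f_I|^p |dζ| / 2π )^{1/p}`, over all subarcs `I`, with values in
`[0, ∞]`. -/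
def seminorm (p η : ℝ) (f : T → ℂ) : ℝ≥0∞ :=
  ⨆ (a : ℝ) (b : ℝ) (_ : a < b) (_ : b ≤ a + 2 * Real.pi),
    ((∫⁻ t in arc a b, ‖f t - mean f (arc a b)‖ₑ ^ p ∂σ) / (σ (arc a b)) ^ η) ^ (1 / p)

/-- The Campanato norm: the sum of the `L^p` norm and of the Campanato seminorm. -/
def norm (p η : ℝ) (f : T → ℂ) : ℝ≥0∞ :=
  eLpNorm f (ENNReal.ofReal p) σ + seminorm p η f

/-- Membership in the Campanato space `ℒ_{p,η}` of the circle. -/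
def MemCampanato (p η : ℝ) (f : T → ℂ) : Prop :=
  MemLp f (ENNReal.ofReal p) σ ∧ seminorm p η f < ∞

/-- `F` has a radial limit at almost every point of the circle. -/
def HasRadialLimits (F : ℂ → ℂ) : Prop :=
  ∀ᵐ t ∂σ, ∃ l : ℂ, Tendsto (fun r : ℝ => F (r * pt t)) (𝓝[<] 1) (𝓝 l)

/-- The boundary function `e^{it} ↦ lim_{r → 1-} F (r e^{it})`; meaningful where the limit
exists, thus always used along with `HasRadialLimits`. -/
def boundary (F : ℂ → ℂ) (t : T) : ℂ :=
  limUnder (𝓝[<] (1 : ℝ)) (fun r : ℝ => F (r * pt t))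

/-- Membership in the Hardy space `H^p` of the unit disk. Only the values of `F` in the open
unit disk matter. -/
def MemHardy (p : ℝ) (F : ℂ → ℂ) : Prop :=
  DifferentiableOn ℂ F (Metric.ball 0 1) ∧
    (⨆ r : Set.Ioo (0 : ℝ) 1,
      eLpNorm (fun t : T => F ((r : ℝ) * pt t)) (ENNReal.ofReal p) σ) < ∞

/-- Membership in the analytic Campanato space: the `H^p` functions whose boundary function is
in the Campanato space. -/
def MemAnalyticCampanato (p η : ℝ) (F : ℂ → ℂ) : Prop :=
  MemHardy p F ∧ HasRadialLimits F ∧ MemCampanato p η (boundary F)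

/-- The Szegő projection
`Sf(z) = (1 / 2π) ∫_0^{2π} f(e^{iθ}) / (1 - z e^{-iθ}) dθ`, for `|z| < 1`. -/
def szego (f : T → ℂ) (z : ℂ) : ℂ :=
  ∫ t, f t / (1 - z * conj (pt t)) ∂σ

/-- The harmonic conjugate in the disk
`(1 / 2π) ∫_0^{2π} Im ((e^{iθ} + z) / (e^{iθ} - z)) f(e^{iθ}) dθ`, for `|z| < 1`. -/
def conjugate (f : T → ℂ) (z : ℂ) : ℂ :=
  ∫ t, (((pt t + z) / (pt t - z)).im : ℂ) * f t ∂σ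

end

end Campanato

namespace Campanato

/-! The proof is Campanato's local-to-global argument for a singular integral, run over the arcs
`dyadicBall x n` of normalized length `2⁻ⁿ`. Let N be the seminorm of f and θ = 2^((1-η)/p). Hölder
turns the Campanato condition into a mean oscillation of at most N θⁿ over such an arc, so the means
over consecutive dyadic arcs differ by at most 2N θⁿ.

To estimate Sf on the arc of index n+1, write f = m + h₁ + h₂, where m is the mean over the
concentric arc of index n, h₁ lives on that arc and h₂ off it. The constant m is reproduced. The
part h₁ is handled by M. Riesz's theorem, since its `L^p` norm is at most N 2^(-nη/p). For h₂ the
Cauchy kernel varies by at most a multiple of 4ʲ/2ⁿ on the j-th annulus (`norm_inv_sub_inv_le`);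
summing against the oscillations leads to a geometric series of ratio 2θ, controlled by its last
term because 2θ > 1, that is η < 1+p (`norm_szego_sub_szego_le`). Thus S h₂ oscillates by at most a
constant times N θⁿ, the required order.

Boundary values need three classical facts. M. Riesz: for f ≥ 0 the Herglotz integral F has positive
real part, and a pointwise inequality for |Im F|^p is integrated using the mean value property of
F^p; duality gives p > 2. Strong convergence: the dilated projections are uniformly bounded and
converge on trigonometric polynomials, so they converge in `L^p` to some G, and Sf is the Poisson
integral of G. Fatou: that integral has radial limit G almost everywhere.

The conjugate function follows from 2Sf - ∫f = Pf + i f̃, where P is the Poisson integral. For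
surjectivity the boundary function is its own preimage: Cauchy's formula holds for the dilates of F,
which converge in `L¹` by Vitali's theorem (`szego_boundary_eq`). -/

/-! ### Cauchy, Poisson and Herglotz integrals on the circle -/

theorem norm_pt (t : T) : ‖pt t‖ = 1 := Circle.norm_coe _

theorem pt_ne_zero (t : T) : pt t ≠ 0 := by simp [pt]

@[fun_prop]
theorem continuous_pt : Continuous pt :=
  continuous_subtype_val.comp AddCircle.continuous_toCircle

theorem pt_mul_conj (t : T) : pt t * conj (pt t) = 1 := by
  rw [Complex.mul_conj, Complex.normSq_eq_norm_sq, norm_pt]; simp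

theorem integral_eq_circleAverage {E : Type*} [NormedAddCommGroup E] [NormedSpace ℝ E]
    (G : ℂ → E) (r : ℝ) :
    ∫ t, G (r * pt t) ∂σ = Real.circleAverage G 0 r := by
  rw [AddCircle.integral_haarAddCircle, Real.circleAverage,
    ← AddCircle.intervalIntegral_preimage (2 * Real.pi) 0]
  simp [pt_coe, circleMap]

theorem norm_ofReal_mul_pt {r : ℝ} (hr : 0 ≤ r) (t : T) : ‖(r : ℂ) * pt t‖ = r := by
  simp [norm_pt, abs_of_nonneg hr]

theorem mul_pt_mem_ball {r : ℝ} (hr : 0 ≤ r) (hr1 : r < 1) (t : T) :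
    (r : ℂ) * pt t ∈ Metric.ball (0 : ℂ) 1 := by
  rw [mem_ball_zero_iff, norm_ofReal_mul_pt hr]; exact hr1

/-- The mean value property on the circle of radius `r`. -/
theorem integral_mul_pt_of_differentiableOn {F : ℂ → ℂ}
    (hF : DifferentiableOn ℂ F (Metric.ball 0 1)) {r : ℝ} (hr : 0 ≤ r) (hr1 : r < 1) :
    ∫ t, F (r * pt t) ∂σ = F 0 := by
  rw [integral_eq_circleAverage]
  refine DiffContOnCl.circleAverage (DifferentiableOn.diffContOnCl (hF.mono ?_))
  refine (Metric.closure_ball_subset_closedBall).trans ?_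
  exact Metric.closedBall_subset_ball (by rwa [abs_of_nonneg hr])

theorem one_sub_mul_conj_pt (z : ℂ) (t : T) : 1 - z * conj (pt t) = (pt t - z) / pt t := by
  rw [eq_div_iff (pt_ne_zero t), sub_mul, mul_assoc, mul_comm (conj _), pt_mul_conj]; ring

theorem norm_one_sub_mul_conj_pt (z : ℂ) (t : T) :
    ‖1 - z * conj (pt t)‖ = ‖pt t - z‖ := by
  rw [one_sub_mul_conj_pt, norm_div, norm_pt, div_one]

theorem one_sub_norm_le_norm_pt_sub (z : ℂ) (t : T) : 1 - ‖z‖ ≤ ‖pt t - z‖ := by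
  have := norm_sub_norm_le (pt t) z
  rwa [norm_pt] at this

theorem pt_sub_ne_zero {z : ℂ} (hz : ‖z‖ < 1) (t : T) : pt t - z ≠ 0 := by
  have := one_sub_norm_le_norm_pt_sub z t
  rw [← norm_pos_iff]; linarith

theorem one_sub_mul_conj_pt_ne_zero {z : ℂ} (hz : ‖z‖ < 1) (t : T) : 1 - z * conj (pt t) ≠ 0 := by
  rw [one_sub_mul_conj_pt]; exact div_ne_zero (pt_sub_ne_zero hz t) (pt_ne_zero t)

/-- Cauchy's formula on the unit circle: the Szegő projection reproduces analytic functions. -/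
theorem szego_of_diffContOnCl {F : ℂ → ℂ} (hF : DiffContOnCl ℂ F (Metric.ball 0 1))
    {z : ℂ} (hz : ‖z‖ < 1) : szego (fun t => F (pt t)) z = F z := by
  have h := DiffContOnCl.circleAverage_smul_div (c := 0) (R := 1) (f := F) (w := z) (by simpa)
    (by simpa using hz)
  rw [← h, ← integral_eq_circleAverage, szego]
  refine integral_congr_ae (Eventually.of_forall fun t => ?_)
  have h1 := pt_sub_ne_zero hz t
  have h2 := pt_ne_zero t
  simp only [one_sub_mul_conj_pt, Complex.ofReal_one, one_mul, sub_zero, smul_eq_mul]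
  field_simp

/-- The Poisson kernel of the disk. -/
noncomputable def poisson (z : ℂ) (t : T) : ℝ := ((pt t + z) / (pt t - z)).re

theorem poisson_eq (z : ℂ) (t : T) : poisson z t = (1 - ‖z‖ ^ 2) / ‖pt t - z‖ ^ 2 := by
  have := congrFun (poissonKernel_eq_re_herglotzRieszKernel (c := 0) (w := z)) (pt t)
  simp only [poissonKernel_def, sub_zero, norm_pt] at this
  simpa [poisson, herglotzRieszKernel_def] using this.symm

theorem poisson_nonneg {z : ℂ} (hz : ‖z‖ < 1) (t : T) : 0 ≤ poisson z t := by
  rw [poisson_eq]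
  have : ‖z‖ ^ 2 ≤ 1 := by nlinarith [norm_nonneg z]
  exact div_nonneg (by linarith) (by positivity)

/-- The Poisson integral of `f`. -/
noncomputable def poissonIntegral (f : T → ℂ) (z : ℂ) : ℂ := ∫ t, (poisson z t : ℂ) * f t ∂σ

theorem poissonIntegral_of_diffContOnCl {F : ℂ → ℂ} (hF : DiffContOnCl ℂ F (Metric.ball 0 1))
    {z : ℂ} (hz : ‖z‖ < 1) : poissonIntegral (fun t => F (pt t)) z = F z := by
  have h := hF.circleAverage_re_herglotzRieszKernel_smul' (w := z) (by simpa using hz)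
  rw [← h, ← integral_eq_circleAverage, poissonIntegral]
  simp [poisson]

theorem poissonIntegral_const (c : ℂ) {z : ℂ} (hz : ‖z‖ < 1) :
    poissonIntegral (fun _ => c) z = c :=
  poissonIntegral_of_diffContOnCl (F := fun _ => c) diffContOnCl_const hz

theorem szego_const (c : ℂ) {z : ℂ} (hz : ‖z‖ < 1) : szego (fun _ => c) z = c :=
  szego_of_diffContOnCl (F := fun _ => c) diffContOnCl_const hz

theorem integral_poisson {z : ℂ} (hz : ‖z‖ < 1) : ∫ t, poisson z t ∂σ = 1 := by
  have h := poissonIntegral_const 1 hz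
  simp only [poissonIntegral, mul_one] at h
  rw [integral_complex_ofReal] at h
  exact_mod_cast h

@[fun_prop]
theorem continuous_herglotz {z : ℂ} (hz : ‖z‖ < 1) :
    Continuous fun t : T => (pt t + z) / (pt t - z) :=
  (continuous_pt.add continuous_const).div (continuous_pt.sub continuous_const)
    fun t => pt_sub_ne_zero hz t

theorem continuous_poisson {z : ℂ} (hz : ‖z‖ < 1) : Continuous (poisson z) :=
  Complex.continuous_re.comp (continuous_herglotz hz)

theorem continuous_inv_one_sub {z : ℂ} (hz : ‖z‖ < 1) :
    Continuous fun t : T => (1 - z * conj (pt t))⁻¹ :=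
  Continuous.inv₀ (by fun_prop) fun t => one_sub_mul_conj_pt_ne_zero hz t

theorem integrable_mul_continuous {f k : T → ℂ} (hf : Integrable f σ) (hk : Continuous k) :
    Integrable (fun t => f t * k t) σ := by
  obtain ⟨C, hC⟩ := isCompact_univ.exists_bound_of_continuousOn hk.continuousOn
  exact hf.mul_bdd (c := C) hk.aestronglyMeasurable
    (Eventually.of_forall fun t => hC t (Set.mem_univ t))

theorem integrable_szego {f : T → ℂ} (hf : Integrable f σ) {z : ℂ} (hz : ‖z‖ < 1) :
    Integrable (fun t => f t / (1 - z * conj (pt t))) σ := by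
  simpa [div_eq_mul_inv] using integrable_mul_continuous hf (continuous_inv_one_sub hz)

theorem integrable_poissonIntegral {f : T → ℂ} (hf : Integrable f σ) {z : ℂ} (hz : ‖z‖ < 1) :
    Integrable (fun t => (poisson z t : ℂ) * f t) σ := by
  simpa [mul_comm] using
    integrable_mul_continuous hf (Complex.continuous_ofReal.comp (continuous_poisson hz))

theorem integrable_conjugate {f : T → ℂ} (hf : Integrable f σ) {z : ℂ} (hz : ‖z‖ < 1) :
    Integrable (fun t => (((pt t + z) / (pt t - z)).im : ℂ) * f t) σ := by
  simpa [mul_comm] using integrable_mul_continuous hf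
    (Complex.continuous_ofReal.comp (Complex.continuous_im.comp (continuous_herglotz hz)))

theorem szego_add {f g : T → ℂ} (hf : Integrable f σ) (hg : Integrable g σ) {z : ℂ}
    (hz : ‖z‖ < 1) : szego (fun t => f t + g t) z = szego f z + szego g z := by
  simp only [szego, add_div]
  exact integral_add (integrable_szego hf hz) (integrable_szego hg hz)

theorem szego_sub {f g : T → ℂ} (hf : Integrable f σ) (hg : Integrable g σ) {z : ℂ}
    (hz : ‖z‖ < 1) : szego (fun t => f t - g t) z = szego f z - szego g z := by
  simp only [szego, sub_div]
  exact integral_sub (integrable_szego hf hz) (integrable_szego hg hz)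

theorem szego_const_mul (c : ℂ) (f : T → ℂ) (z : ℂ) :
    szego (fun t => c * f t) z = c * szego f z := by
  simp only [szego, mul_div_assoc]
  exact integral_const_mul _ _

theorem szego_congr_ae {f g : T → ℂ} (h : f =ᵐ[σ] g) : szego f = szego g := by
  funext z
  refine integral_congr_ae ?_
  filter_upwards [h] with t ht
  rw [ht]

/-- The Herglotz integral `2 Sf - ∫ f` splits into the Poisson integral and `i` times
the conjugate function. -/
theorem two_mul_szego_sub {f : T → ℂ} (hf : Integrable f σ) {z : ℂ} (hz : ‖z‖ < 1) :
    2 * szego f z - ∫ t, f t ∂σ = poissonIntegral f z + Complex.I * conjugate f z := by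
  rw [szego, poissonIntegral, conjugate, ← integral_const_mul, ← integral_const_mul,
    ← integral_sub ((integrable_szego hf hz).const_mul 2) hf,
    ← integral_add (integrable_poissonIntegral hf hz) ((integrable_conjugate hf hz).const_mul _)]
  refine integral_congr_ae (Eventually.of_forall fun t => ?_)
  have h1 := pt_sub_ne_zero hz t
  have h2 := pt_ne_zero t
  have h3 : (((poisson z t : ℝ) : ℂ) + Complex.I * (((pt t + z) / (pt t - z)).im : ℂ))
      = (pt t + z) / (pt t - z) := by
    rw [poisson, mul_comm, Complex.re_add_im]
  calc 2 * (f t / (1 - z * conj (pt t))) - f t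
      = ((pt t + z) / (pt t - z)) * f t := by
        rw [one_sub_mul_conj_pt]; field_simp; ring
    _ = _ := by rw [← h3]; ring

theorem differentiableOn_szego {f : T → ℂ} (hf : Integrable f σ) :
    DifferentiableOn ℂ (szego f) (Metric.ball 0 1) := by
  intro z₀ hz₀
  rw [mem_ball_zero_iff] at hz₀
  -- Half the distance to the circle: on the ball of radius ε about `z₀` all kernel denominators
  -- stay at least ε in modulus.
  set ε := (1 - ‖z₀‖) / 2 with hε
  have hεpos : 0 < ε := by rw [hε]; linarith
  have hball : ∀ z ∈ Metric.ball z₀ ε, ‖z‖ < 1 ∧ ε ≤ 1 - ‖z‖ := by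
    intro z hz
    rw [mem_ball_iff_norm] at hz
    have : ‖z‖ ≤ ‖z - z₀‖ + ‖z₀‖ := by simpa using norm_add_le (z - z₀) z₀
    constructor <;> linarith
  have key := hasDerivAt_integral_of_dominated_loc_of_deriv_le (μ := σ)
    (F := fun z t => f t / (1 - z * conj (pt t)))
    (F' := fun z t => f t * conj (pt t) / (1 - z * conj (pt t)) ^ 2)
    (x₀ := z₀) (s := Metric.ball z₀ ε) (bound := fun t => ‖f t‖ / ε ^ 2)
    (Metric.ball_mem_nhds _ hεpos) ?_ (integrable_szego hf hz₀) ?_ ?_ ?_ ?_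
  · exact key.2.differentiableAt.differentiableWithinAt
  · filter_upwards [Metric.ball_mem_nhds z₀ hεpos] with z hz
    exact (integrable_szego hf (hball z hz).1).aestronglyMeasurable
  · have : Continuous fun t : T => conj (pt t) * ((1 - z₀ * conj (pt t))⁻¹) ^ 2 :=
      (by fun_prop : Continuous fun t : T => conj (pt t)).mul ((continuous_inv_one_sub hz₀).pow 2)
    refine (integrable_mul_continuous hf this).aestronglyMeasurable.congr
      (Eventually.of_forall fun t => ?_)
    simp only [div_eq_mul_inv, inv_pow]; ring
  · refine Eventually.of_forall fun t z hz => ?_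
    have h1 := (hball z hz).2
    have h2 := one_sub_norm_le_norm_pt_sub z t
    rw [norm_div, norm_mul, norm_pow, norm_one_sub_mul_conj_pt, RCLike.norm_conj, norm_pt, mul_one]
    gcongr
    linarith
  · exact hf.norm.div_const _
  · refine Eventually.of_forall fun t z hz => ?_
    have hne := one_sub_mul_conj_pt_ne_zero (hball z hz).1 t
    have h1 : HasDerivAt (fun z : ℂ => 1 - z * conj (pt t)) (-(conj (pt t))) z := by
      simpa using ((hasDerivAt_id z).mul_const (conj (pt t))).const_sub 1
    have h2 := (hasDerivAt_const z (f t)).div h1 hne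
    simp only [zero_mul, zero_sub, mul_neg, neg_neg] at h2
    exact h2

/-! ### Arc distance against chordal distance -/

theorem exists_coe_eq_abs_eq_norm (u : T) : ∃ x : ℝ, (x : T) = u ∧ |x| = ‖u‖ := by
  induction u using QuotientAddGroup.induction_on with
  | H x =>
    refine ⟨x - round ((2 * Real.pi)⁻¹ * x) * (2 * Real.pi), ?_, (AddCircle.norm_eq _).symm⟩
    rw [AddCircle.coe_sub, sub_eq_self, ← zsmul_eq_mul, AddCircle.coe_zsmul, AddCircle.coe_period,
      smul_zero]

theorem norm_le_pi (u : T) : ‖u‖ ≤ Real.pi := by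
  have := AddCircle.norm_le_half_period (2 * Real.pi) (x := u) (by positivity)
  rw [abs_of_pos Real.two_pi_pos] at this
  linarith

theorem norm_pt_sub_pt (s t : T) : ‖pt s - pt t‖ = ‖pt (s - t) - 1‖ := by
  have : pt s = pt (s - t) * pt t := by
    simp only [pt, ← Circle.coe_mul, ← AddCircle.toCircle_add, sub_add_cancel]
  have h : pt s - pt t = (pt (s - t) - 1) * pt t := by rw [sub_mul, ← this, one_mul]
  rw [h, norm_mul, norm_pt, mul_one]

theorem norm_pt_sub_pt_le (s t : T) : ‖pt s - pt t‖ ≤ dist s t := by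
  obtain ⟨x, hx, hx'⟩ := exists_coe_eq_abs_eq_norm (s - t)
  rw [norm_pt_sub_pt, dist_eq_norm, ← hx', ← hx, pt_coe, mul_comm]
  exact Real.norm_exp_I_mul_ofReal_sub_one_le

theorem dist_le_norm_pt_sub_pt (s t : T) : 2 / Real.pi * dist s t ≤ ‖pt s - pt t‖ := by
  obtain ⟨x, hx, hx'⟩ := exists_coe_eq_abs_eq_norm (s - t)
  have hpi := norm_le_pi (s - t)
  rw [norm_pt_sub_pt, dist_eq_norm, ← hx', ← hx, pt_coe, mul_comm _ Complex.I,
    Complex.norm_exp_I_mul_ofReal_sub_one, norm_mul, Real.norm_eq_abs, Real.norm_eq_abs]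
  have := Real.mul_abs_le_abs_sin (x := x / 2) (by rw [abs_div, abs_two, hx']; linarith)
  rw [abs_div, abs_two] at this
  rw [abs_two]
  linarith

/-- Moving from `r * pt s` out to `pt s` costs 1 - r, which is itself at most the distance from `r *
pt s` to any point of the circle. -/
theorem norm_pt_sub_pt_le_two_mul (s t : T) {r : ℝ} (hr : 0 ≤ r) (hr1 : r ≤ 1) :
    ‖pt t - pt s‖ ≤ 2 * ‖pt t - r * pt s‖ := by
  have h1 : ‖pt t - pt s‖ ≤ ‖pt t - r * pt s‖ + ‖(r : ℂ) * pt s - pt s‖ := by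
    simpa using norm_add_le (pt t - r * pt s) (r * pt s - pt s)
  have h2 : ‖(r : ℂ) * pt s - pt s‖ = 1 - r := by
    have : (r : ℂ) * pt s - pt s = ((r - 1 : ℝ) : ℂ) * pt s := by push_cast; ring
    rw [this, norm_mul, norm_pt, Complex.norm_real, Real.norm_eq_abs, abs_sub_comm,
      abs_of_nonneg (by linarith), mul_one]
  have h3 := one_sub_norm_le_norm_pt_sub (r * pt s) t
  rw [norm_ofReal_mul_pt hr] at h3
  linarith

/-- The distance on the circle is controlled by the distance to the dilated point. -/
theorem dist_le_norm_pt_sub_mul_pt (s t : T) {r : ℝ} (hr : 0 ≤ r) (hr1 : r ≤ 1) :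
    dist t s ≤ Real.pi * ‖pt t - r * pt s‖ := by
  have h1 := dist_le_norm_pt_sub_pt t s
  have h2 := norm_pt_sub_pt_le_two_mul s t hr hr1
  have := Real.pi_pos
  rw [div_mul_eq_mul_div, div_le_iff₀ this] at h1
  nlinarith

/-- The dyadic ball `B_n` about `x` has measure `2⁻ⁿ`. -/
theorem measure_closedBall_dyadic (x : T) (n : ℕ) :
    σ (Metric.closedBall x (Real.pi / 2 ^ n)) = 2⁻¹ ^ n := by
  have h := AddCircle.volume_closedBall (2 * Real.pi) (x := x) (Real.pi / 2 ^ n)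
  have h2 : min (2 * Real.pi) (2 * (Real.pi / 2 ^ n)) = 2 * Real.pi * (2⁻¹ ^ n) := by
    have h1 : (2⁻¹ : ℝ) ^ n ≤ 1 := pow_le_one₀ (by norm_num) (by norm_num)
    rw [min_eq_right]
    · simp [div_eq_mul_inv]; ring
    · simp only [div_eq_mul_inv, ← inv_pow]; nlinarith [Real.pi_pos]
  rw [h2, AddCircle.volume_eq_smul_haarAddCircle, Measure.smul_apply, smul_eq_mul,
    ENNReal.ofReal_mul (q := 2⁻¹ ^ n) (by positivity), ENNReal.ofReal_pow (by positivity),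
    ENNReal.ofReal_inv_of_pos (by norm_num)] at h
  have h3 : ENNReal.ofReal (2 * Real.pi) ≠ 0 := by
    simpa using Real.pi_pos
  rw [ENNReal.mul_right_inj h3 ENNReal.ofReal_ne_top] at h
  simpa using h

/-! ### The theorem of M. Riesz -/

/-- The pointwise inequality behind the theorem of M. Riesz, on the right half-plane. -/
theorem exists_abs_im_rpow_le {p : ℝ} (hp : 1 < p) (hp2 : p ≤ 2) :
    ∃ A B : ℝ, 0 ≤ A ∧ 0 ≤ B ∧ ∀ w : ℂ, 0 < w.re →
      |w.im| ^ p ≤ A * w.re ^ p - B * (w ^ (p : ℂ)).re := by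
  have hpi := Real.pi_pos
  -- The midpoint of π/(2p) and π/2: below θ the cosine of the argument is bounded away from zero,
  -- while beyond θ the argument of w^p has passed π/2.
  set θ := (Real.pi / 2 + Real.pi / (2 * p)) / 2 with hθ
  have hp0 : 0 < p := by linarith
  have hθp : θ * p = (p * Real.pi / 2 + Real.pi / 2) / 2 := by
    rw [hθ]; field_simp
  have hθ1 : Real.pi / 2 < θ * p := by rw [hθp]; nlinarith
  have hθ2 : θ < Real.pi / 2 := by
    have : Real.pi / (2 * p) < Real.pi / 2 := by
      apply div_lt_div_of_pos_left hpi (by norm_num); linarith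
    linarith
  have hθ0 : 0 < θ := by positivity
  have hκ : Real.cos (θ * p) < 0 := by
    apply Real.cos_neg_of_pi_div_two_lt_of_lt hθ1
    nlinarith
  have hc : 0 < Real.cos θ := Real.cos_pos_of_mem_Ioo ⟨by linarith, hθ2⟩
  set B := (-Real.cos (θ * p))⁻¹ with hB
  have hB0 : 0 < B := inv_pos.2 (by linarith)
  refine ⟨(1 + B) / Real.cos θ ^ p, B, by positivity, hB0.le, fun w hw => ?_⟩
  have hw0 : w ≠ 0 := by rintro rfl; simp at hw
  have hn : 0 < ‖w‖ := norm_pos_iff.2 hw0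
  have harg : |w.arg| < Real.pi / 2 := Complex.abs_arg_lt_pi_div_two_iff.2 (Or.inl hw)
  have hre : w.re = ‖w‖ * Real.cos |w.arg| := by
    rw [Real.cos_abs, Complex.norm_mul_cos_arg]
  have hcp : (w ^ (p : ℂ)).re = ‖w‖ ^ p * Real.cos (|w.arg| * p) := by
    rw [Complex.cpow_ofReal_re]
    congr 1
    rw [← Real.cos_abs (w.arg * p), abs_mul, abs_of_pos hp0]
  have him : |w.im| ^ p ≤ ‖w‖ ^ p * 1 := by
    rw [mul_one]
    exact Real.rpow_le_rpow (abs_nonneg _) (Complex.abs_im_le_norm w) hp0.le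
  have hcos : 0 < Real.cos |w.arg| :=
    Real.cos_pos_of_mem_Ioo ⟨by linarith [abs_nonneg w.arg], harg⟩
  rw [hre, hcp, Real.mul_rpow hn.le hcos.le]
  have hnp : 0 < ‖w‖ ^ p := Real.rpow_pos_of_pos hn p
  suffices h : 1 ≤ (1 + B) / Real.cos θ ^ p * Real.cos |w.arg| ^ p
      - B * Real.cos (|w.arg| * p) by
    calc |w.im| ^ p ≤ ‖w‖ ^ p * 1 := him
      _ ≤ ‖w‖ ^ p * ((1 + B) / Real.cos θ ^ p * Real.cos |w.arg| ^ p
          - B * Real.cos (|w.arg| * p)) := by gcongr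
      _ = _ := by ring
  -- For large arguments the term with B alone reaches 1; p ≤ 2 keeps p |arg w| within [0, π], where
  -- cosine decreases. For small arguments the A-term is at least 1 + B and absorbs whatever the
  -- B-term subtracts.
  rcases le_total θ |w.arg| with h | h
  · have h1 : Real.cos (|w.arg| * p) ≤ Real.cos (θ * p) := by
      apply Real.cos_le_cos_of_nonneg_of_le_pi (by positivity)
      · nlinarith
      · gcongr
    have h2 : B * Real.cos (|w.arg| * p) ≤ -1 := by
      calc B * Real.cos (|w.arg| * p) ≤ B * Real.cos (θ * p) := by gcongr
        _ = -1 := by rw [hB, inv_neg, neg_mul, inv_mul_cancel₀ hκ.ne]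
    have h3 : 0 ≤ (1 + B) / Real.cos θ ^ p * Real.cos |w.arg| ^ p := by positivity
    linarith
  · have h1 : Real.cos θ ≤ Real.cos |w.arg| :=
      Real.cos_le_cos_of_nonneg_of_le_pi (abs_nonneg _) (by linarith) h
    have h2 : Real.cos θ ^ p ≤ Real.cos |w.arg| ^ p := Real.rpow_le_rpow hc.le h1 hp0.le
    have h3 : 1 + B ≤ (1 + B) / Real.cos θ ^ p * Real.cos |w.arg| ^ p := by
      rw [div_mul_eq_mul_div, le_div_iff₀ (by positivity)]
      gcongr
    have h4 := mul_le_mul_of_nonneg_left (Real.cos_le_one (|w.arg| * p)) hB0.le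
    linarith

theorem eLpNorm_ofReal_eq {p : ℝ} (hp : 0 < p) (f : T → ℂ) :
    eLpNorm f (ENNReal.ofReal p) σ = (∫⁻ t, ‖f t‖ₑ ^ p ∂σ) ^ (1 / p) := by
  rw [eLpNorm_eq_lintegral_rpow_enorm_toReal (by simpa using hp) ENNReal.ofReal_ne_top,
    ENNReal.toReal_ofReal hp.le]

theorem norm_pt_sub_mul_pt_comm (r : ℝ) (s t : T) :
    ‖pt t - r * pt s‖ = ‖pt s - r * pt t‖ := by
  have h : pt t - r * pt s = conj (pt s - r * pt t) * (pt s * pt t) := by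
    have h1 := pt_mul_conj s
    have h2 := pt_mul_conj t
    rw [map_sub, map_mul, Complex.conj_ofReal]
    linear_combination (-pt t) * h1 + (r * pt s) * h2
  rw [h, norm_mul, norm_mul, norm_pt, norm_pt, RCLike.norm_conj]; ring

/-- The symmetry makes the kernel integrate to one in its other variable too, which is what Tonelli
needs for the `L^p` contraction. -/
theorem poisson_comm {r : ℝ} (hr : 0 ≤ r) (s t : T) :
    poisson (r * pt s) t = poisson (r * pt t) s := by
  rw [poisson_eq, poisson_eq, norm_ofReal_mul_pt hr, norm_ofReal_mul_pt hr,
    norm_pt_sub_mul_pt_comm]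

theorem lintegral_poisson {z : ℂ} (hz : ‖z‖ < 1) :
    ∫⁻ t, ENNReal.ofReal (poisson z t) ∂σ = 1 := by
  rw [← ofReal_integral_eq_lintegral_ofReal, integral_poisson hz, ENNReal.ofReal_one]
  · exact (continuous_poisson hz).integrable_of_hasCompactSupport
      (HasCompactSupport.of_compactSpace _)
  · exact Eventually.of_forall fun t => poisson_nonneg hz t

theorem enorm_poissonIntegral_le {z : ℂ} (hz : ‖z‖ < 1) (f : T → ℂ) :
    ‖poissonIntegral f z‖ₑ ≤ ∫⁻ t, ENNReal.ofReal (poisson z t) * ‖f t‖ₑ ∂σ := by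
  refine (enorm_integral_le_lintegral_enorm _).trans (lintegral_mono fun t => ?_)
  rw [enorm_mul, ← ofReal_norm (poisson z t : ℂ), Complex.norm_real, Real.norm_eq_abs,
    abs_of_nonneg (poisson_nonneg hz t)]

/-- Jensen's inequality: the Poisson kernel is a probability density, and the `L¹` norm for that
density is at most its `L^p` norm. -/
theorem enorm_poissonIntegral_rpow_le {p : ℝ} (hp : 1 ≤ p) {z : ℂ} (hz : ‖z‖ < 1) {f : T → ℂ}
    (hf : AEStronglyMeasurable f σ) :
    ‖poissonIntegral f z‖ₑ ^ p ≤ ∫⁻ t, ENNReal.ofReal (poisson z t) * ‖f t‖ₑ ^ p ∂σ := by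
  have hp0 : 0 < p := by linarith
  set w : T → ℝ≥0∞ := fun t => ENNReal.ofReal (poisson z t) with hw
  have hwm : Measurable w := (continuous_poisson hz).measurable.ennreal_ofReal
  have : IsProbabilityMeasure (σ.withDensity w) := ⟨by
    rw [withDensity_apply _ MeasurableSet.univ, Measure.restrict_univ]
    exact lintegral_poisson hz⟩
  have hac := withDensity_absolutelyContinuous σ w
  have h := eLpNorm_le_eLpNorm_of_exponent_le (μ := σ.withDensity w)
    (p := 1) (q := ENNReal.ofReal p) (by simpa using hp) (hf.mono_ac hac)
  rw [eLpNorm_one_eq_lintegral_enorm, eLpNorm_eq_lintegral_rpow_enorm_toReal (by simpa using hp0)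
    ENNReal.ofReal_ne_top, ENNReal.toReal_ofReal hp0.le,
    lintegral_withDensity_eq_lintegral_mul₀ hwm.aemeasurable hf.enorm,
    lintegral_withDensity_eq_lintegral_mul₀ hwm.aemeasurable (hf.enorm.pow_const p)] at h
  have h2 := ENNReal.rpow_le_rpow ((enorm_poissonIntegral_le hz f).trans h) hp0.le
  rwa [one_div, ENNReal.rpow_inv_rpow hp0.ne'] at h2

theorem continuous_poisson_uncurry {r : ℝ} (hr : 0 ≤ r) (hr1 : r < 1) :
    Continuous fun x : T × T => poisson (r * pt x.1) x.2 := by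
  have : (fun x : T × T => poisson (r * pt x.1) x.2)
      = fun x : T × T => (1 - r ^ 2) / ‖pt x.2 - r * pt x.1‖ ^ 2 := by
    funext x; rw [poisson_eq, norm_ofReal_mul_pt hr]
  rw [this]
  refine continuous_const.div (by fun_prop) fun x => ?_
  have := pt_sub_ne_zero (z := r * pt x.1) (by rwa [norm_ofReal_mul_pt hr]) x.2
  simpa using this

/-- The Poisson integral is a contraction of `L^p`. -/
theorem eLpNorm_poissonIntegral_le {p : ℝ} (hp : 1 ≤ p) {f : T → ℂ}
    (hf : AEStronglyMeasurable f σ) {r : ℝ} (hr : 0 ≤ r) (hr1 : r < 1) :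
    eLpNorm (fun t => poissonIntegral f (r * pt t)) (ENNReal.ofReal p) σ
      ≤ eLpNorm f (ENNReal.ofReal p) σ := by
  have hp0 : 0 < p := by linarith
  have hz : ∀ t, ‖(r : ℂ) * pt t‖ < 1 := fun t => by rwa [norm_ofReal_mul_pt hr]
  rw [eLpNorm_ofReal_eq hp0, eLpNorm_ofReal_eq hp0]
  refine ENNReal.rpow_le_rpow ?_ (by positivity)
  calc ∫⁻ s, ‖poissonIntegral f (r * pt s)‖ₑ ^ p ∂σ
      ≤ ∫⁻ s, ∫⁻ t, ENNReal.ofReal (poisson (r * pt s) t) * ‖f t‖ₑ ^ p ∂σ ∂σ :=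
        lintegral_mono fun s => enorm_poissonIntegral_rpow_le hp (hz s) hf
    _ = ∫⁻ t, ∫⁻ s, ENNReal.ofReal (poisson (r * pt s) t) * ‖f t‖ₑ ^ p ∂σ ∂σ := by
        refine lintegral_lintegral_swap ?_
        exact ((continuous_poisson_uncurry hr hr1).measurable.ennreal_ofReal.aemeasurable).mul
          ((hf.enorm.pow_const p).comp_snd)
    _ = ∫⁻ t, ‖f t‖ₑ ^ p ∂σ := by
        refine lintegral_congr fun t => ?_
        simp_rw [poisson_comm hr _ t]
        rw [lintegral_mul_const _ (continuous_poisson (hz t)).measurable.ennreal_ofReal,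
          lintegral_poisson (hz t), one_mul]

theorem continuous_szego_mul_pt {f : T → ℂ} (hf : Integrable f σ) {r : ℝ} (hr : 0 ≤ r)
    (hr1 : r < 1) : Continuous fun t => szego f (r * pt t) :=
  (differentiableOn_szego hf).continuousOn.comp_continuous (by fun_prop)
    fun t => mul_pt_mem_ball hr hr1 t

theorem memLp_of_continuous {f : T → ℂ} (hf : Continuous f) (p : ℝ≥0∞) : MemLp f p σ := by
  obtain ⟨C, hC⟩ := isCompact_univ.exists_bound_of_continuousOn hf.continuousOn
  exact MemLp.of_bound hf.aestronglyMeasurable C (Eventually.of_forall fun t => hC t trivial)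

theorem eLpNorm_le_of_integral_le {p : ℝ} (hp : 0 < p) {u v : T → ℂ} (hu : Continuous u)
    (hv : Continuous v) {A : ℝ} (hA : 0 ≤ A)
    (h : ∫ t, ‖v t‖ ^ p ∂σ ≤ A * ∫ t, ‖u t‖ ^ p ∂σ) :
    eLpNorm v (ENNReal.ofReal p) σ
      ≤ ENNReal.ofReal (A ^ p⁻¹) * eLpNorm u (ENNReal.ofReal p) σ := by
  have h0 : ENNReal.ofReal p ≠ 0 := by simpa using hp
  rw [(memLp_of_continuous hu _).eLpNorm_eq_integral_rpow_norm h0 ENNReal.ofReal_ne_top,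
    (memLp_of_continuous hv _).eLpNorm_eq_integral_rpow_norm h0 ENNReal.ofReal_ne_top,
    ENNReal.toReal_ofReal hp.le, ← ENNReal.ofReal_mul (by positivity)]
  have h1 : 0 ≤ ∫ t, ‖u t‖ ^ p ∂σ := integral_nonneg fun t => by positivity
  have h2 : 0 ≤ ∫ t, ‖v t‖ ^ p ∂σ := integral_nonneg fun t => by positivity
  rw [← Real.mul_rpow hA h1]
  exact ENNReal.ofReal_le_ofReal (Real.rpow_le_rpow h2 h (by positivity))

theorem MemLp.integrable_of_one_le {p : ℝ} (hp : 1 ≤ p) {f : T → ℂ}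
    (hf : MemLp f (ENNReal.ofReal p) σ) : Integrable f σ :=
  hf.integrable (by simpa using hp)

theorem poisson_pos {z : ℂ} (hz : ‖z‖ < 1) (t : T) : 0 < poisson z t := by
  rw [poisson_eq]
  have h1 : ‖z‖ ^ 2 < 1 := by nlinarith [norm_nonneg z]
  have h2 : 0 < ‖pt t - z‖ := norm_pos_iff.2 (pt_sub_ne_zero hz t)
  exact div_pos (by linarith) (by positivity)

theorem enorm_integral_le_eLpNorm {p : ℝ} (hp : 1 ≤ p) {f : T → ℂ}
    (hf : AEStronglyMeasurable f σ) : ‖∫ t, f t ∂σ‖ₑ ≤ eLpNorm f (ENNReal.ofReal p) σ := by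
  refine (enorm_integral_le_lintegral_enorm _).trans ?_
  rw [← eLpNorm_one_eq_lintegral_enorm]
  exact eLpNorm_le_eLpNorm_of_exponent_le (by simpa using hp) hf

/-- The theorem of M. Riesz for nonnegative functions and `1 < p ≤ 2`. -/
theorem exists_eLpNorm_szego_le_of_nonneg {p : ℝ} (hp : 1 < p) (hp2 : p ≤ 2) :
    ∃ C : ℝ≥0, ∀ f : T → ℝ, (∀ t, 0 ≤ f t) → MemLp (fun t => (f t : ℂ)) (ENNReal.ofReal p) σ →
      ∀ r : ℝ, 0 ≤ r → r < 1 →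
        eLpNorm (fun t => szego (fun s => (f s : ℂ)) (r * pt t)) (ENNReal.ofReal p) σ
          ≤ C * eLpNorm (fun t => (f t : ℂ)) (ENNReal.ofReal p) σ := by
  obtain ⟨A, B, hA, hB, hAB⟩ := exists_abs_im_rpow_le hp hp2
  have hp0 : 0 < p := by linarith
  -- A^(1/p) comes from Im F; the 2 counts Re F and the mean of f. The factor 1/2 in Sf = (F + ∫f)/2
  -- is discarded.
  refine ⟨Real.toNNReal (A ^ p⁻¹) + 2, fun f hf0 hf r hr hr1 => ?_⟩
  set fc : T → ℂ := fun t => (f t : ℂ) with hfc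
  have hint : Integrable fc σ := MemLp.integrable_of_one_le hp.le hf
  have hz : ∀ t, ‖(r : ℂ) * pt t‖ < 1 := fun t => by rwa [norm_ofReal_mul_pt hr]
  -- The null function is set aside so that Re F > 0 strictly, which makes F^p holomorphic on the
  -- principal branch.
  by_cases hzero : f =ᵐ[σ] 0
  · have h0 : fc =ᵐ[σ] fun _ => 0 := by
      filter_upwards [hzero] with t ht
      simp [hfc, ht]
    rw [szego_congr_ae h0]
    simp [szego]
  set F : ℂ → ℂ := fun z => 2 * szego fc z - ∫ t, fc t ∂σ with hF
  have hFd : DifferentiableOn ℂ F (Metric.ball 0 1) :=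
    ((differentiableOn_szego hint).const_mul 2).sub_const _
  have hFe : ∀ z, ‖z‖ < 1 → F z = poissonIntegral fc z + Complex.I * conjugate fc z :=
    fun z hz => two_mul_szego_sub hint hz
  have hP : ∀ z, poissonIntegral fc z = ((∫ t, poisson z t * f t ∂σ : ℝ) : ℂ) := by
    intro z
    rw [poissonIntegral, ← integral_complex_ofReal]
    simp [hfc]
  have hQ : ∀ z, conjugate fc z
      = ((∫ t, ((pt t + z) / (pt t - z)).im * f t ∂σ : ℝ) : ℂ) := by
    intro z
    rw [conjugate, ← integral_complex_ofReal]
    simp [hfc]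
  have hre : ∀ z, ‖z‖ < 1 → (F z).re = ∫ t, poisson z t * f t ∂σ := by
    intro z hz; rw [hFe z hz, hP, hQ]; simp
  have hpos : ∀ z, ‖z‖ < 1 → 0 < (F z).re := by
    intro z hz
    rw [hre z hz, integral_pos_iff_support_of_nonneg]
    · have hs : Function.support (fun t => poisson z t * f t) = Function.support f := by
        ext t; simp [(poisson_pos hz t).ne']
      rw [hs, pos_iff_ne_zero]
      intro h0
      refine hzero ?_
      rw [Filter.EventuallyEq, ae_iff]
      exact h0
    · intro t; exact mul_nonneg (poisson_nonneg hz t) (hf0 t)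
    · have h1 := (integrable_poissonIntegral hint hz).re
      simpa [hfc] using h1
  -- the mean value property of `F ^ p`
  have hFp : DifferentiableOn ℂ (fun z => F z ^ (p : ℂ)) (Metric.ball 0 1) := by
    refine hFd.cpow_const fun z hz => ?_
    exact Or.inl (hpos z (by simpa using hz))
  have hmean := integral_mul_pt_of_differentiableOn hFp hr hr1
  have hcF : Continuous fun t => F (r * pt t) :=
    hFd.continuousOn.comp_continuous (by fun_prop) fun t => mul_pt_mem_ball hr hr1 t
  have hcFp : Continuous fun t => F (r * pt t) ^ (p : ℂ) :=
    hFp.continuousOn.comp_continuous (f := fun t : T => (r : ℂ) * pt t) (by fun_prop)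
      fun t => mul_pt_mem_ball hr hr1 t
  have hci : ∀ g : T → ℝ, Continuous g → Integrable g σ := fun g hg =>
    hg.integrable_of_hasCompactSupport (HasCompactSupport.of_compactSpace _)
  -- F(0) is the mean of f, a positive real, so the term with B has a favourable sign after
  -- integration and can be dropped.
  have hF0 : 0 ≤ (F 0 ^ (p : ℂ)).re := by
    have h1 : F 0 = (((F 0).re : ℝ) : ℂ) := by
      rw [hFe 0 (by simp), hP, hQ]
      have : ∀ t : T, ((pt t + 0) / (pt t - 0)).im = 0 := by
        intro t; simp [div_self (pt_ne_zero t)]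
      simp only [this, zero_mul, integral_zero]
      simp
    rw [h1, ← Complex.ofReal_cpow (hpos 0 (by simp)).le, Complex.ofReal_re]
    exact Real.rpow_nonneg (hpos 0 (by simp)).le _
  have hcre : Continuous fun t => (((F (r * pt t)).re : ℝ) : ℂ) :=
    Complex.continuous_ofReal.comp (Complex.continuous_re.comp hcF)
  have hcim : Continuous fun t => (((F (r * pt t)).im : ℝ) : ℂ) :=
    Complex.continuous_ofReal.comp (Complex.continuous_im.comp hcF)
  have hv : eLpNorm (fun t => (((F (r * pt t)).im : ℝ) : ℂ)) (ENNReal.ofReal p) σ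
      ≤ ENNReal.ofReal (A ^ p⁻¹)
        * eLpNorm (fun t => (((F (r * pt t)).re : ℝ) : ℂ)) (ENNReal.ofReal p) σ := by
    refine eLpNorm_le_of_integral_le hp0 hcre hcim hA ?_
    have i1 := hci _ ((hcre.norm.rpow_const fun t => Or.inr hp0.le))
    have i2 := hci _ ((hcim.norm.rpow_const fun t => Or.inr hp0.le))
    have i3 : Integrable (fun t => (F (r * pt t) ^ (p : ℂ)).re) σ :=
      hci _ (Complex.continuous_re.comp hcFp)
    calc ∫ t, ‖(((F (r * pt t)).im : ℝ) : ℂ)‖ ^ p ∂σ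
        ≤ ∫ t, (A * ‖(((F (r * pt t)).re : ℝ) : ℂ)‖ ^ p - B * (F (r * pt t) ^ (p : ℂ)).re) ∂σ := by
          refine integral_mono i2 ((i1.const_mul A).sub (i3.const_mul B)) fun t => ?_
          have h := hAB _ (hpos _ (hz t))
          simpa [abs_of_pos (hpos _ (hz t))] using h
      _ = A * ∫ t, ‖(((F (r * pt t)).re : ℝ) : ℂ)‖ ^ p ∂σ - B * (F 0 ^ (p : ℂ)).re := by
          rw [integral_sub (i1.const_mul A) (i3.const_mul B), integral_const_mul,
            integral_const_mul]
          congr 2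
          rw [← hmean]
          exact integral_re (𝕜 := ℂ) (memLp_one_iff_integrable.1 (memLp_of_continuous hcFp 1))
      _ ≤ _ := by nlinarith [mul_nonneg hB hF0]
  have hu : eLpNorm (fun t => (((F (r * pt t)).re : ℝ) : ℂ)) (ENNReal.ofReal p) σ
      ≤ eLpNorm fc (ENNReal.ofReal p) σ := by
    refine le_trans (le_of_eq ?_)
      (eLpNorm_poissonIntegral_le hp.le hf.aestronglyMeasurable hr hr1)
    congr 1; funext t
    rw [hre _ (hz t), hP]
  have hdec : (fun t => szego fc (r * pt t))
      = (1 / 2 : ℂ) • ((fun t => (((F (r * pt t)).re : ℝ) : ℂ))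
      + Complex.I • (fun t => (((F (r * pt t)).im : ℝ) : ℂ)) + fun _ => ∫ t, fc t ∂σ) := by
    funext t
    have h := Complex.re_add_im (F (r * pt t))
    simp only [Pi.smul_apply, Pi.add_apply, smul_eq_mul]
    rw [mul_comm Complex.I, h, hF]
    ring
  have hp1 : (1 : ℝ≥0∞) ≤ ENNReal.ofReal p := by simpa using hp.le
  rw [hdec, eLpNorm_const_smul]
  have hhalf : ‖(1 / 2 : ℂ)‖ₑ ≤ 1 := by
    rw [← ofReal_norm]; norm_num
  have hI : ‖Complex.I‖ₑ = 1 := by rw [← ofReal_norm]; simp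
  refine (mul_le_of_le_one_left' hhalf).trans ?_
  refine (eLpNorm_add_le (hcre.add (hcim.const_smul _)).aestronglyMeasurable
    aestronglyMeasurable_const hp1).trans ?_
  refine (add_le_add_left (eLpNorm_add_le hcre.aestronglyMeasurable
    (hcim.const_smul _).aestronglyMeasurable hp1) _).trans ?_
  have hconst : eLpNorm (fun _ : T => ∫ t, fc t ∂σ) (ENNReal.ofReal p) σ
      ≤ eLpNorm fc (ENNReal.ofReal p) σ := by
    rw [eLpNorm_const _ (by simpa using hp0) (NeZero.ne _)]
    simpa using enorm_integral_le_eLpNorm hp.le hf.aestronglyMeasurable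
  rw [eLpNorm_const_smul, hI, one_mul]
  calc _ ≤ eLpNorm fc (ENNReal.ofReal p) σ
        + ENNReal.ofReal (A ^ p⁻¹) * eLpNorm fc (ENNReal.ofReal p) σ
        + eLpNorm fc (ENNReal.ofReal p) σ := by
        gcongr
        exact hv.trans (by gcongr)
    _ = _ := by
        rw [ENNReal.ofReal.eq_1 (A ^ p⁻¹)]; push_cast; ring

theorem eLpNorm_ofReal_comp_le {p : ℝ≥0∞} {f : T → ℂ} {φ : ℂ → ℝ} (hφ : ∀ w, |φ w| ≤ ‖w‖) :
    eLpNorm (fun t => (φ (f t) : ℂ)) p σ ≤ eLpNorm f p σ :=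
  eLpNorm_mono fun t => by simpa using hφ (f t)

/-- The theorem of M. Riesz for `1 < p ≤ 2`. -/
theorem exists_eLpNorm_szego_le_of_le_two {p : ℝ} (hp : 1 < p) (hp2 : p ≤ 2) :
    ∃ C : ℝ≥0, ∀ f : T → ℂ, MemLp f (ENNReal.ofReal p) σ → ∀ r : ℝ, 0 ≤ r → r < 1 →
      eLpNorm (fun t => szego f (r * pt t)) (ENNReal.ofReal p) σ
        ≤ C * eLpNorm f (ENNReal.ofReal p) σ := by
  obtain ⟨C, hC⟩ := exists_eLpNorm_szego_le_of_nonneg hp hp2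
  -- Four pieces: the positive and negative parts of Re f and Im f.
  refine ⟨4 * C, fun f hf r hr hr1 => ?_⟩
  have hp1 : (1 : ℝ≥0∞) ≤ ENNReal.ofReal p := by simpa using hp.le
  have key : ∀ φ : ℂ → ℝ, Continuous φ → (∀ w, 0 ≤ φ w) → (∀ w, |φ w| ≤ ‖w‖) →
      Integrable (fun t => (φ (f t) : ℂ)) σ ∧
      eLpNorm (fun t => szego (fun s => (φ (f s) : ℂ)) (r * pt t)) (ENNReal.ofReal p) σ
        ≤ C * eLpNorm f (ENNReal.ofReal p) σ := by
    intro φ hφ h0 h1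
    have hm : MemLp (fun t => (φ (f t) : ℂ)) (ENNReal.ofReal p) σ :=
      hf.of_le ((Complex.continuous_ofReal.comp hφ).comp_aestronglyMeasurable
        hf.aestronglyMeasurable) (Eventually.of_forall fun t => by simpa using h1 (f t))
    refine ⟨MemLp.integrable_of_one_le hp.le hm, ?_⟩
    refine (hC (fun t => φ (f t)) (fun t => h0 _) hm r hr hr1).trans ?_
    gcongr
    exact eLpNorm_ofReal_comp_le h1
  have hre := Complex.abs_re_le_norm
  have him := Complex.abs_im_le_norm
  have hmax : ∀ x : ℝ, |max x 0| ≤ |x| := fun x => by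
    rw [abs_of_nonneg (le_max_right _ _)]; exact max_le (le_abs_self x) (abs_nonneg x)
  obtain ⟨i1, k1⟩ := key (fun w => max w.re 0) (by fun_prop) (fun w => le_max_right _ _)
    fun w => (hmax _).trans (hre w)
  obtain ⟨i2, k2⟩ := key (fun w => max (-w.re) 0) (by fun_prop) (fun w => le_max_right _ _)
    fun w => (hmax _).trans ((abs_neg _).trans_le (hre w))
  obtain ⟨i3, k3⟩ := key (fun w => max w.im 0) (by fun_prop) (fun w => le_max_right _ _)
    fun w => (hmax _).trans (him w)
  obtain ⟨i4, k4⟩ := key (fun w => max (-w.im) 0) (by fun_prop) (fun w => le_max_right _ _)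
    fun w => (hmax _).trans ((abs_neg _).trans_le (him w))
  set f1 : T → ℂ := fun t => ((max (f t).re 0 : ℝ) : ℂ)
  set f2 : T → ℂ := fun t => ((max (-(f t).re) 0 : ℝ) : ℂ)
  set f3 : T → ℂ := fun t => ((max (f t).im 0 : ℝ) : ℂ)
  set f4 : T → ℂ := fun t => ((max (-(f t).im) 0 : ℝ) : ℂ)
  have hmm : ∀ x : ℝ, ((max x 0 : ℝ) : ℂ) - ((max (-x) 0 : ℝ) : ℂ) = (x : ℂ) := fun x => by
    rw [← Complex.ofReal_sub, max_zero_sub_max_neg_zero_eq_self]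
  have hfd : f = fun t => (f1 t - f2 t) + Complex.I * (f3 t - f4 t) := by
    funext t
    simp only [f1, f2, f3, f4, hmm]
    rw [mul_comm, Complex.re_add_im]
  have hdec : (fun t => szego f (r * pt t))
      = ((fun t => szego f1 (r * pt t)) - fun t => szego f2 (r * pt t)) + Complex.I •
        ((fun t => szego f3 (r * pt t)) - fun t => szego f4 (r * pt t)) := by
    funext t
    have hz : ‖(r : ℂ) * pt t‖ < 1 := by rwa [norm_ofReal_mul_pt hr]
    have e1 := szego_add (f := fun t => f1 t - f2 t) (g := fun t => Complex.I * (f3 t - f4 t))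
      (i1.sub i2) ((i3.sub i4).const_mul _) hz
    rw [← hfd, szego_const_mul, szego_sub i1 i2 hz, szego_sub i3 i4 hz] at e1
    exact e1
  have c1 := (continuous_szego_mul_pt i1 hr hr1).aestronglyMeasurable (μ := σ)
  have c2 := (continuous_szego_mul_pt i2 hr hr1).aestronglyMeasurable (μ := σ)
  have c3 := (continuous_szego_mul_pt i3 hr hr1).aestronglyMeasurable (μ := σ)
  have c4 := (continuous_szego_mul_pt i4 hr hr1).aestronglyMeasurable (μ := σ)
  have hI : ‖Complex.I‖ₑ = 1 := by rw [← ofReal_norm]; simp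
  rw [hdec]
  refine (eLpNorm_add_le (c1.sub c2) ((c3.sub c4).const_smul _) hp1).trans ?_
  rw [eLpNorm_const_smul, hI, one_mul]
  refine (add_le_add ((eLpNorm_sub_le c1 c2 hp1).trans (add_le_add k1 k2))
    ((eLpNorm_sub_le c3 c4 hp1).trans (add_le_add k3 k4))).trans (le_of_eq ?_)
  push_cast; ring

/-- The dilated Szegő projection is self-adjoint. -/
theorem integral_szego_mul_conj {f g : T → ℂ} (hf : Integrable f σ) (hg : Integrable g σ) {r : ℝ}
    (hr : 0 ≤ r) (hr1 : r < 1) :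
    ∫ s, szego f (r * pt s) * conj (g s) ∂σ = ∫ t, f t * conj (szego g (r * pt t)) ∂σ := by
  have hne : ∀ s t : T, 1 - (r : ℂ) * pt s * conj (pt t) ≠ 0 := fun s t =>
    one_sub_mul_conj_pt_ne_zero (by rwa [norm_ofReal_mul_pt hr]) t
  -- For fixed r < 1 the kernel is bounded on the torus, so Fubini applies to merely integrable f
  -- and g.
  have hcont : Continuous fun x : T × T => (1 - (r : ℂ) * pt x.1 * conj (pt x.2))⁻¹ :=
    Continuous.inv₀ (by fun_prop) fun x => hne x.1 x.2
  obtain ⟨C, hC⟩ := isCompact_univ.exists_bound_of_continuousOn hcont.continuousOn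
  have hgc : Integrable (fun s => conj (g s)) σ :=
    (Complex.conjCLE.toContinuousLinearMap).integrable_comp hg
  have hint : Integrable (fun x : T × T =>
      (conj (g x.1) * f x.2) * (1 - (r : ℂ) * pt x.1 * conj (pt x.2))⁻¹) (σ.prod σ) :=
    (hgc.mul_prod hf).mul_bdd (c := C) hcont.aestronglyMeasurable
      (Eventually.of_forall fun x => hC x trivial)
  calc ∫ s, szego f (r * pt s) * conj (g s) ∂σ
      = ∫ s, ∫ t, (conj (g s) * f t) * (1 - (r : ℂ) * pt s * conj (pt t))⁻¹ ∂σ ∂σ := by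
        refine integral_congr_ae (Eventually.of_forall fun s => ?_)
        simp only [szego]
        rw [← integral_mul_const]
        refine integral_congr_ae (Eventually.of_forall fun t => ?_)
        simp only [div_eq_mul_inv]; ring
    _ = ∫ t, ∫ s, (conj (g s) * f t) * (1 - (r : ℂ) * pt s * conj (pt t))⁻¹ ∂σ ∂σ :=
        integral_integral_swap hint
    _ = _ := by
        refine integral_congr_ae (Eventually.of_forall fun t => ?_)
        simp only [szego]
        rw [← integral_conj, ← integral_const_mul]
        refine integral_congr_ae (Eventually.of_forall fun s => ?_)
        simp only [div_eq_mul_inv, map_mul, map_inv₀, map_sub, map_one, Complex.conj_ofReal,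
          Complex.conj_conj]
        rw [show (r : ℂ) * conj (pt t) * pt s = r * pt s * conj (pt t) by ring]
        ring

/-- The theorem of M. Riesz for `p > 2`, by duality. -/
theorem exists_eLpNorm_szego_le_of_two_lt {p : ℝ} (hp : 2 < p) :
    ∃ C : ℝ≥0, ∀ f : T → ℂ, MemLp f (ENNReal.ofReal p) σ → ∀ r : ℝ, 0 ≤ r → r < 1 →
      eLpNorm (fun t => szego f (r * pt t)) (ENNReal.ofReal p) σ
        ≤ C * eLpNorm f (ENNReal.ofReal p) σ := by
  have hp0 : 0 < p := by linarith
  have hpq : p.HolderConjugate (p / (p - 1)) := Real.HolderConjugate.conjExponent (by linarith)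
  set q := p / (p - 1) with hq
  have hq2 : q ≤ 2 := by rw [hq, div_le_iff₀ (by linarith)]; linarith
  have hq1 : 1 < q := hpq.symm.lt
  have hq0 : 0 < q := by linarith
  obtain ⟨C, hC⟩ := exists_eLpNorm_szego_le_of_le_two hq1 hq2
  refine ⟨C, fun f hf r hr hr1 => ?_⟩
  have hfi : Integrable f σ := MemLp.integrable_of_one_le (by linarith) hf
  set h : T → ℂ := fun t => szego f (r * pt t) with hh
  have hc : Continuous h := continuous_szego_mul_pt hfi hr hr1
  -- The extremal function in Hölder's inequality: |g|^q = |h|^p and h times the conjugate of g is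
  -- |h|^p.
  set g : T → ℂ := fun t => ((‖h t‖ ^ (p - 2) : ℝ) : ℂ) * h t with hg
  have hgc : Continuous g :=
    (Complex.continuous_ofReal.comp (hc.norm.rpow_const fun t => Or.inr (by linarith))).mul hc
  have hgm := memLp_of_continuous hgc (ENNReal.ofReal q)
  have hgi : Integrable g σ := MemLp.integrable_of_one_le hq1.le hgm
  have hgn : ∀ t, ‖g t‖ₑ ^ q = ‖h t‖ₑ ^ p := by
    intro t
    have h1 : ‖g t‖ ^ q = ‖h t‖ ^ p := by
      rw [hg]
      simp only [norm_mul, Complex.norm_real, Real.norm_eq_abs]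
      rw [abs_of_nonneg (by positivity)]
      rcases eq_or_lt_of_le (norm_nonneg (h t)) with h0 | h0
      · rw [← h0, mul_zero, Real.zero_rpow hq0.ne', Real.zero_rpow hp0.ne']
      · rw [← Real.rpow_add_one h0.ne', ← Real.rpow_mul h0.le]
        congr 1
        rw [hq]
        have : p - 1 ≠ 0 := by linarith
        field_simp
        ring
    rw [← ofReal_norm, ← ofReal_norm, ENNReal.ofReal_rpow_of_nonneg (norm_nonneg _) hq0.le,
      ENNReal.ofReal_rpow_of_nonneg (norm_nonneg _) hp0.le, h1]
  set X := ∫⁻ t, ‖h t‖ₑ ^ p ∂σ with hX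
  have hXfin : X ≠ ∞ := by
    have := (memLp_of_continuous hc (ENNReal.ofReal p)).eLpNorm_lt_top
    rw [eLpNorm_ofReal_eq hp0] at this
    intro htop
    rw [← hX, htop, ENNReal.top_rpow_of_pos (by positivity)] at this
    exact lt_irrefl _ this
  have hprod : ∀ t, h t * conj (g t) = ((‖h t‖ ^ p : ℝ) : ℂ) := by
    intro t
    rw [hg]
    simp only [map_mul, Complex.conj_ofReal]
    rw [mul_left_comm, Complex.mul_conj, Complex.normSq_eq_norm_sq, ← Complex.ofReal_mul]
    congr 1
    rcases eq_or_lt_of_le (norm_nonneg (h t)) with h0 | h0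
    · rw [← h0, Real.zero_rpow hp0.ne']; simp
    · rw [← Real.rpow_natCast, ← Real.rpow_add h0]; congr 1; push_cast; ring
  have hXle : X ≤ ∫⁻ t, ‖f t‖ₑ * ‖szego g (r * pt t)‖ₑ ∂σ := by
    have e1 : X = ‖∫ t, h t * conj (g t) ∂σ‖ₑ := by
      simp_rw [hprod]
      rw [integral_complex_ofReal, ← ofReal_norm, Complex.norm_real, Real.norm_eq_abs,
        abs_of_nonneg (integral_nonneg fun t => by positivity),
        ofReal_integral_eq_lintegral_ofReal]
      · refine lintegral_congr fun t => ?_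
        rw [← ofReal_norm, ENNReal.ofReal_rpow_of_nonneg (norm_nonneg _) hp0.le]
      · exact (hc.norm.rpow_const fun t => Or.inr hp0.le).integrable_of_hasCompactSupport
          (HasCompactSupport.of_compactSpace _)
      · exact Eventually.of_forall fun t => by positivity
    rw [e1, integral_szego_mul_conj hfi hgi hr hr1]
    refine (enorm_integral_le_lintegral_enorm _).trans (le_of_eq (lintegral_congr fun t => ?_))
    rw [enorm_mul, ← ofReal_norm (conj _), RCLike.norm_conj, ofReal_norm]
  have hHolder := ENNReal.lintegral_mul_le_Lp_mul_Lq σ hpq (f := fun t => ‖f t‖ₑ)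
    (g := fun t => ‖szego g (r * pt t)‖ₑ) hf.aestronglyMeasurable.enorm
    (continuous_szego_mul_pt hgi hr hr1).aestronglyMeasurable.enorm
  have hS := hC g hgm r hr hr1
  rw [← eLpNorm_ofReal_eq hp0, ← eLpNorm_ofReal_eq hq0] at hHolder
  rw [eLpNorm_ofReal_eq hq0 g] at hS
  simp_rw [hgn] at hS
  -- Self-adjointness moved the projection onto g, where the bound for q ≤ 2 applies. It remains to
  -- cancel X^(1/q), which is legitimate because continuity of h makes X finite.
  have hmain : X ≤ (C * eLpNorm f (ENNReal.ofReal p) σ) * X ^ (1 / q) := by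
    calc X ≤ _ := hXle
      _ ≤ _ := hHolder
      _ ≤ eLpNorm f (ENNReal.ofReal p) σ * (C * X ^ (1 / q)) := by gcongr
      _ = _ := by ring
  rw [eLpNorm_ofReal_eq hp0 h]
  change X ^ (1 / p) ≤ _
  rcases eq_or_ne X 0 with h0 | h0
  · rw [h0, ENNReal.zero_rpow_of_pos (by positivity)]; exact zero_le
  have hsplit : X = X ^ (1 / p) * X ^ (1 / q) := by
    rw [← ENNReal.rpow_add _ _ h0 hXfin]
    have : 1 / p + 1 / q = 1 := by simpa using hpq.inv_add_inv_eq_one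
    rw [this, ENNReal.rpow_one]
  have hpos : X ^ (1 / q) ≠ 0 := by
    simp [h0, hXfin]
  have hfin : X ^ (1 / q) ≠ ∞ := ENNReal.rpow_ne_top_of_nonneg (by positivity) hXfin
  exact (ENNReal.mul_le_mul_iff_left hpos hfin).1 (hsplit.symm.le.trans hmain)

/-- The theorem of M. Riesz: the dilated Szegő projections are uniformly bounded on `L^p`. -/
theorem exists_eLpNorm_szego_le {p : ℝ} (hp : 1 < p) :
    ∃ C : ℝ≥0, ∀ f : T → ℂ, MemLp f (ENNReal.ofReal p) σ → ∀ r : ℝ, 0 ≤ r → r < 1 →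
      eLpNorm (fun t => szego f (r * pt t)) (ENNReal.ofReal p) σ
        ≤ C * eLpNorm f (ENNReal.ofReal p) σ := by
  rcases le_or_gt p 2 with h | h
  · exact exists_eLpNorm_szego_le_of_le_two hp h
  · exact exists_eLpNorm_szego_le_of_two_lt h

/-! ### Dyadic arcs, Lebesgue points and Fatou's theorem -/

/-- The arc of normalized length `2⁻ⁿ` centered at `x`. -/
def dyadicBall (x : T) (n : ℕ) : Set T := Metric.closedBall x (Real.pi / 2 ^ n)

theorem measurableSet_dyadicBall (x : T) (n : ℕ) : MeasurableSet (dyadicBall x n) :=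
  Metric.isClosed_closedBall.measurableSet

theorem measure_dyadicBall (x : T) (n : ℕ) : σ (dyadicBall x n) = 2⁻¹ ^ n :=
  measure_closedBall_dyadic x n

theorem dyadicBall_zero (x : T) : dyadicBall x 0 = Set.univ := by
  rw [dyadicBall]
  refine AddCircle.closedBall_eq_univ_of_half_period_le _ Real.two_pi_pos.ne' _ ?_
  rw [abs_of_pos Real.two_pi_pos]; simp

theorem dyadicBall_anti (x : T) {m n : ℕ} (h : m ≤ n) : dyadicBall x n ⊆ dyadicBall x m := by
  refine Metric.closedBall_subset_closedBall ?_
  have := Real.pi_pos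
  gcongr
  norm_num

/-- Splitting an integral over the circle into dyadic annuli about `x`. -/
theorem lintegral_mul_le_sum_dyadicBall (x : T) (n : ℕ) {K φ : T → ℝ≥0∞} {M : ℕ → ℝ≥0∞}
    (hφ : AEMeasurable φ σ) (hin : ∀ t ∈ dyadicBall x n, K t ≤ M n)
    (hout : ∀ j < n, ∀ t ∉ dyadicBall x (j + 1), K t ≤ M j) :
    ∫⁻ t, K t * φ t ∂σ
      ≤ ∑ j ∈ Finset.range (n + 1), M j * ∫⁻ t in dyadicBall x j, φ t ∂σ := by
  have hpt : ∀ t, K t * φ t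
      ≤ ∑ j ∈ Finset.range (n + 1), (dyadicBall x j).indicator (fun t => M j * φ t) t := by
    intro t
    have key : ∃ j ∈ Finset.range (n + 1), t ∈ dyadicBall x j ∧ K t ≤ M j := by
      by_cases ht : t ∈ dyadicBall x n
      · exact ⟨n, by simp, ht, hin t ht⟩
      · have hex : ∃ k, t ∉ dyadicBall x k := ⟨n, ht⟩
        classical
        -- The first arc missing t has positive index because the arc of index 0 is the whole
        -- circle; its predecessor contains t.
        obtain ⟨j, hj⟩ : ∃ j, Nat.find hex = j + 1 := by
          refine Nat.exists_eq_succ_of_ne_zero fun h0 => ?_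
          have := Nat.find_spec hex
          rw [h0, dyadicBall_zero] at this
          exact this trivial
        have hjn : j + 1 ≤ n := hj ▸ Nat.find_min' hex ht
        have h1 : t ∉ dyadicBall x (j + 1) := hj ▸ Nat.find_spec hex
        have h2 : t ∈ dyadicBall x j := not_not.1 (Nat.find_min hex (by omega))
        exact ⟨j, by simp; omega, h2, hout j hjn t h1⟩
    obtain ⟨j, hj, htj, hK⟩ := key
    refine le_trans ?_ (Finset.single_le_sum (fun i _ => zero_le) hj)
    rw [Set.indicator_of_mem htj]
    gcongr
  refine (lintegral_mono hpt).trans ?_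
  rw [lintegral_finsetSum' _ fun j _ =>
    (hφ.const_mul _).indicator (measurableSet_dyadicBall x j)]
  refine Finset.sum_le_sum fun j _ => ?_
  rw [lintegral_indicator (measurableSet_dyadicBall x j), lintegral_const_mul'' _ hφ.restrict]

/-- The sums obey s(n+1) = s(n)/2 + a(n+1), a contraction with vanishing input. With a(j) the
average deviation at a Lebesgue point, they dominate the error of the Poisson integral. -/
theorem tendsto_sum_geometric_mul {a : ℕ → ℝ} (ha : Tendsto a atTop (𝓝 0)) :
    Tendsto (fun n => ∑ j ∈ Finset.range (n + 1), 2 ^ j / 2 ^ n * a j) atTop (𝓝 0) := by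
  set s : ℕ → ℝ := fun n => ∑ j ∈ Finset.range (n + 1), 2 ^ j / 2 ^ n * a j with hs
  have hrec : ∀ n, s (n + 1) = s n / 2 + a (n + 1) := by
    intro n
    simp only [hs]
    rw [Finset.sum_range_succ, div_self (by positivity), one_mul, Finset.sum_div]
    congr 1
    refine Finset.sum_congr rfl fun j _ => ?_
    rw [pow_succ]; field_simp
  rw [Metric.tendsto_atTop] at ha ⊢
  intro ε hε
  obtain ⟨N, hN⟩ := ha (ε / 4) (by positivity)
  have hb : ∀ k, |s (N + k)| ≤ ε / 2 + |s N| * (1 / 2) ^ k := by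
    intro k
    induction k with
    | zero => simp; linarith
    | succ k ih =>
      have h1 := hN (N + k + 1) (by omega)
      rw [Real.dist_eq, sub_zero] at h1
      rw [← add_assoc, hrec, pow_succ]
      have h2 := abs_add_le (s (N + k) / 2) (a (N + k + 1))
      rw [abs_div, abs_two] at h2
      linarith
  have hlim : Tendsto (fun k : ℕ => |s N| * (1 / 2 : ℝ) ^ k) atTop (𝓝 0) := by
    simpa using (tendsto_pow_atTop_nhds_zero_of_lt_one (r := (1 / 2 : ℝ)) (by norm_num)
      (by norm_num)).const_mul |s N|
  obtain ⟨K, hK⟩ := (Metric.tendsto_atTop.1 hlim) (ε / 2) (by positivity)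
  refine ⟨N + K, fun n hn => ?_⟩
  obtain ⟨k, rfl⟩ := Nat.exists_eq_add_of_le (show N ≤ n by omega)
  have h1 := hK k (by omega)
  rw [Real.dist_eq, sub_zero] at h1 ⊢
  have h2 := le_abs_self (|s N| * (1 / 2 : ℝ) ^ k)
  linarith [hb k]

/-- Almost every point is a Lebesgue point, along dyadic balls. -/
theorem ae_tendsto_dyadic_average {g : T → ℂ} (hg : Integrable g σ) :
    ∀ᵐ x ∂σ, Tendsto (fun n : ℕ => 2 ^ n * ∫ t in dyadicBall x n, ‖g t - g x‖ ∂σ) atTop (𝓝 0) := by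
  have hc : ENNReal.ofReal (2 * Real.pi) ≠ 0 := by simpa using Real.pi_pos
  have hgv : Integrable g (volume : Measure T) := by
    rw [AddCircle.volume_eq_smul_haarAddCircle]
    exact hg.smul_measure ENNReal.ofReal_ne_top
  have h := IsUnifLocDoublingMeasure.ae_tendsto_average_norm_sub (volume : Measure T)
    hgv.locallyIntegrable 1
  rw [AddCircle.volume_eq_smul_haarAddCircle, Measure.ae_ennreal_smul_measure_iff hc] at h
  filter_upwards [h] with x hx
  have hδ : Tendsto (fun n : ℕ => Real.pi / 2 ^ n) atTop (𝓝[>] 0) := by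
    refine tendsto_nhdsWithin_iff.2 ⟨?_, Eventually.of_forall fun n => ?_⟩
    · have := (tendsto_pow_atTop_nhds_zero_of_lt_one (r := (1 / 2 : ℝ)) (by norm_num)
        (by norm_num)).const_mul Real.pi
      simpa [div_eq_mul_inv] using this
    · exact div_pos Real.pi_pos (by positivity)
  have h1 := hx (fun _ => x) _ hδ (Eventually.of_forall fun n => by
    simp only [Metric.mem_closedBall, dist_self, one_mul]
    exact div_nonneg Real.pi_pos.le (by positivity))
  refine h1.congr fun n => ?_
  change ⨍ t in dyadicBall x n, ‖g t - g x‖ ∂(ENNReal.ofReal (2 * Real.pi) • σ) = _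
  have hm : (ENNReal.ofReal (2 * Real.pi) • σ).real (dyadicBall x n)
      = 2 * Real.pi * (2 ^ n)⁻¹ := by
    rw [Measure.real, Measure.smul_apply, measure_dyadicBall, smul_eq_mul, ENNReal.toReal_mul,
      ENNReal.toReal_ofReal Real.two_pi_pos.le]
    simp
  rw [setAverage_eq, hm, Measure.restrict_smul, integral_smul_measure,
    ENNReal.toReal_ofReal Real.two_pi_pos.le, smul_eq_mul, smul_eq_mul]
  have := Real.pi_pos
  field_simp

theorem exists_dyadic_scale {ρ : ℝ} (h0 : 0 < ρ) (h1 : ρ ≤ 1) :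
    ∃ n : ℕ, (1 / 2 : ℝ) ^ (n + 1) < ρ ∧ ρ ≤ (1 / 2) ^ n :=
  exists_nat_pow_near_of_lt_one h0 h1 (by norm_num) (by norm_num)

theorem poisson_le_of_le {r : ℝ} (hr : 0 ≤ r) (hr1 : r < 1) {d : ℝ} (hd : 0 < d) (s t : T)
    (h : d ≤ ‖pt t - r * pt s‖) : poisson (r * pt s) t ≤ 2 * (1 - r) / d ^ 2 := by
  rw [poisson_eq, norm_ofReal_mul_pt hr]
  have : 1 - r ^ 2 ≤ 2 * (1 - r) := by nlinarith
  have h0 : 0 ≤ 1 - r := by linarith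
  gcongr

/-- Fatou's theorem: the Poisson integral of an integrable function has that function as its
radial limit almost everywhere. -/
theorem ae_tendsto_poissonIntegral {g : T → ℂ} (hg : Integrable g σ) :
    ∀ᵐ x ∂σ, Tendsto (fun r : ℝ => poissonIntegral g (r * pt x)) (𝓝[<] 1) (𝓝 (g x)) := by
  filter_upwards [ae_tendsto_dyadic_average hg] with x hx
  have hs := tendsto_sum_geometric_mul hx
  have hφ : Integrable (fun t => g t - g x) σ := hg.sub (integrable_const _)
  rw [Metric.tendsto_nhds]
  intro ε hε
  obtain ⟨N, hN⟩ := (Metric.tendsto_atTop.1 hs) (ε / 8) (by positivity)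
  have hlt : 1 - (1 / 2 : ℝ) ^ N < 1 := by
    have : (0 : ℝ) < (1 / 2) ^ N := by positivity
    linarith
  filter_upwards [Ioo_mem_nhdsLT hlt] with r hr
  have hr0 : 0 ≤ r := by
    have : (1 / 2 : ℝ) ^ N ≤ 1 := pow_le_one₀ (by norm_num) (by norm_num)
    linarith [hr.1]
  have hz : ‖(r : ℂ) * pt x‖ < 1 := by rw [norm_ofReal_mul_pt hr0]; exact hr.2
  -- The scale 2⁻ⁿ ≈ 1 - r is the width of the Poisson kernel: no finer annuli are needed, and on
  -- the j-th one the kernel is at most 8·4ʲ/2ⁿ.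
  obtain ⟨n, hn1, hn2⟩ := exists_dyadic_scale (ρ := 1 - r) (by linarith [hr.2]) (by linarith)
  have hNn : N ≤ n := by
    by_contra hlt
    have : (1 / 2 : ℝ) ^ N ≤ (1 / 2) ^ (n + 1) :=
      pow_le_pow_of_le_one (by norm_num) (by norm_num) (by omega)
    linarith [hr.1]
  have hbound := lintegral_mul_le_sum_dyadicBall x n
    (K := fun t => ENNReal.ofReal (poisson (r * pt x) t))
    (φ := fun t => ‖g t - g x‖ₑ) (M := fun j => ENNReal.ofReal (8 * 4 ^ j / 2 ^ n))
    hφ.aestronglyMeasurable.enorm ?_ ?_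
  · have hle : ‖poissonIntegral g (r * pt x) - g x‖ₑ
        ≤ ENNReal.ofReal (8 * ∑ j ∈ Finset.range (n + 1),
          2 ^ j / 2 ^ n * (2 ^ j * ∫ t in dyadicBall x j, ‖g t - g x‖ ∂σ)) := by
      have e1 : poissonIntegral g (r * pt x) - g x
          = poissonIntegral (fun t => g t - g x) (r * pt x) := by
        conv_lhs => rw [← poissonIntegral_const (g x) hz]
        simp only [poissonIntegral, mul_sub]
        exact (integral_sub (integrable_poissonIntegral hg hz)
          (integrable_poissonIntegral (integrable_const _) hz)).symm
      rw [e1]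
      refine (enorm_poissonIntegral_le hz _).trans (hbound.trans (le_of_eq ?_))
      rw [Finset.mul_sum, ENNReal.ofReal_sum_of_nonneg]
      · refine Finset.sum_congr rfl fun j _ => ?_
        rw [← ofReal_integral_norm_eq_lintegral_enorm hφ.integrableOn,
          ← ENNReal.ofReal_mul (by positivity)]
        congr 1
        have : (4 : ℝ) ^ j = 2 ^ j * 2 ^ j := by rw [← mul_pow]; norm_num
        rw [this]; ring
      · intro j _
        have : 0 ≤ ∫ t in dyadicBall x j, ‖g t - g x‖ ∂σ :=
          integral_nonneg fun t => norm_nonneg _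
        positivity
    have h2 := hN n hNn
    rw [Real.dist_eq, sub_zero] at h2
    have h3 := (le_abs_self _).trans_lt h2
    rw [dist_eq_norm]
    rw [← ofReal_norm] at hle
    have h4 := (ENNReal.ofReal_le_ofReal_iff' .. ).1 hle
    rcases h4 with h4 | h4 <;> linarith
  · intro t _
    refine ENNReal.ofReal_le_ofReal ?_
    have h1 := one_sub_norm_le_norm_pt_sub (r * pt x) t
    rw [norm_ofReal_mul_pt hr0] at h1
    have h5 : 0 < 1 - r := by linarith [hr.2]
    refine (poisson_le_of_le hr0 hr.2 h5 x t h1).trans ?_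
    have h4 : (4 : ℝ) ^ n = 2 ^ n * 2 ^ n := by rw [← mul_pow]; norm_num
    rw [h4, div_le_div_iff₀ (by positivity) (by positivity)]
    rw [one_div, inv_pow, pow_succ, inv_lt_comm₀ (by positivity) h5] at hn1
    rw [inv_eq_one_div, div_lt_iff₀ h5] at hn1
    have h2n : (0 : ℝ) < 2 ^ n := by positivity
    calc 2 * (1 - r) * 2 ^ n = 2 * (1 - r) * 2 ^ n * 1 := by ring
      _ ≤ 2 * (1 - r) * 2 ^ n * (2 ^ n * 2 * (1 - r)) := by gcongr
      _ ≤ _ := by nlinarith [mul_pos h2n (mul_pos h2n (pow_pos h5 2))]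
  · intro j hj t ht
    refine ENNReal.ofReal_le_ofReal ?_
    have h5 : 0 < 1 - r := by linarith [hr.2]
    have h1 := dist_le_norm_pt_sub_mul_pt x t hr0 hr.2.le
    rw [dyadicBall, Metric.mem_closedBall, not_le] at ht
    have h2 : (1 / 2 : ℝ) ^ (j + 1) ≤ ‖pt t - r * pt x‖ := by
      have h3 := ht.trans_le h1
      rw [div_eq_mul_inv, mul_lt_mul_iff_right₀ Real.pi_pos] at h3
      simpa using h3.le
    refine (poisson_le_of_le hr0 hr.2 (by positivity) x t h2).trans ?_
    rw [← pow_mul, mul_comm (j + 1) 2, pow_mul, div_le_div_iff₀ (by positivity) (by positivity)]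
    rw [one_div, inv_pow] at hn2
    have h6 : (1 - r) * 2 ^ n ≤ 1 := by
      rwa [← le_div_iff₀ (by positivity), one_div]
    have h7 : (4 : ℝ) ^ j * ((1 / 2) ^ 2) ^ (j + 1) = 1 / 4 := by
      rw [pow_succ, ← mul_assoc, ← mul_pow]; norm_num
    linarith

/-! ### Boundary values of the Szegő projection in `L^p` -/

theorem integral_pt_of_diffContOnCl {F : ℂ → ℂ} (hF : DiffContOnCl ℂ F (Metric.ball 0 1)) :
    ∫ t, F (pt t) ∂σ = F 0 := by
  have h := poissonIntegral_of_diffContOnCl hF (z := 0) (by simp)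
  simpa [poissonIntegral, poisson_eq, norm_pt] using h

theorem fourier_eq_pt_zpow (n : ℤ) (t : T) : fourier n t = pt t ^ n := by
  rw [fourier_apply, AddCircle.toCircle_zsmul, Circle.coe_zpow, pt]

theorem szego_fourier_natCast (n : ℕ) {z : ℂ} (hz : ‖z‖ < 1) :
    szego (fun t => fourier (n : ℤ) t) z = z ^ n := by
  have := szego_of_diffContOnCl (F := fun w => w ^ n)
    (Differentiable.diffContOnCl (by fun_prop)) hz
  simpa only [fourier_eq_pt_zpow, zpow_natCast] using this

/-- The integrand is the conjugate of the boundary value of w^(n+1) / (1 - z̄ w), which is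
holomorphic on the closed disk and vanishes at 0. -/
theorem szego_fourier_negSucc (n : ℕ) {z : ℂ} (hz : ‖z‖ < 1) :
    szego (fun t => fourier (Int.negSucc n) t) z = 0 := by
  have hne : ∀ w : ℂ, ‖w‖ ≤ 1 → 1 - conj z * w ≠ 0 := by
    intro w hw h
    have h1 : conj z * w = 1 := (sub_eq_zero.1 h).symm
    have h2 : ‖z‖ * ‖w‖ = 1 := by
      rw [← RCLike.norm_conj z, ← norm_mul, h1, norm_one]
    nlinarith [norm_nonneg z, norm_nonneg w]
  have hd : DiffContOnCl ℂ (fun w : ℂ => w ^ (n + 1) / (1 - conj z * w)) (Metric.ball 0 1) := by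
    refine DifferentiableOn.diffContOnCl ?_
    rw [closure_ball _ one_ne_zero]
    intro w hw
    refine DifferentiableAt.differentiableWithinAt ?_
    exact DifferentiableAt.div (by fun_prop) (by fun_prop) (hne w (by simpa using hw))
  have h := integral_pt_of_diffContOnCl hd
  have h2 := congrArg conj h
  rw [← integral_conj] at h2
  simp only [ne_eq, Nat.add_eq_zero_iff, one_ne_zero, and_false, not_false_eq_true, zero_pow,
    zero_div, map_zero] at h2
  rw [szego, ← h2]
  refine integral_congr_ae (Eventually.of_forall fun t => ?_)
  have : (pt t)⁻¹ = conj (pt t) := inv_eq_of_mul_eq_one_right (pt_mul_conj t)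
  simp only [fourier_eq_pt_zpow, zpow_negSucc, map_div₀, map_pow, map_sub, map_one, map_mul,
    Complex.conj_conj, ← inv_pow, this]

/-- The dilated Szegő projection as an operator on `L^p`. -/
noncomputable def szegoLM (p : ℝ≥0∞) [Fact (1 ≤ p)] (r : ℝ) (hr : 0 ≤ r) (hr1 : r < 1) :
    Lp ℂ p σ →ₗ[ℂ] Lp ℂ p σ :=
  have hint : ∀ f : Lp ℂ p σ, Integrable f σ := fun f => (Lp.memLp f).integrable Fact.out
  have hz : ∀ t, ‖(r : ℂ) * pt t‖ < 1 := fun t => by rwa [norm_ofReal_mul_pt hr]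
  { toFun := fun f =>
      (memLp_of_continuous (continuous_szego_mul_pt (hint f) hr hr1) p).toLp _
    map_add' := fun f g => by
      rw [← MemLp.toLp_add]
      refine MemLp.toLp_congr _ _ (Eventually.of_forall fun t => ?_)
      change szego _ _ = szego _ _ + szego _ _
      rw [← szego_add (hint f) (hint g) (hz t)]
      exact congrFun (szego_congr_ae (Lp.coeFn_add f g)) _
    map_smul' := fun c f => by
      rw [RingHom.id_apply, ← MemLp.toLp_const_smul]
      refine MemLp.toLp_congr _ _ (Eventually.of_forall fun t => ?_)
      change szego _ _ = c * szego _ _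
      rw [← szego_const_mul]
      exact congrFun (szego_congr_ae (Lp.coeFn_smul c f)) _ }

theorem coeFn_szegoLM {p : ℝ≥0∞} [Fact (1 ≤ p)] {r : ℝ} (hr : 0 ≤ r) (hr1 : r < 1)
    (f : Lp ℂ p σ) : szegoLM p r hr hr1 f =ᵐ[σ] fun t => szego f (r * pt t) :=
  MemLp.coeFn_toLp (memLp_of_continuous
    (continuous_szego_mul_pt ((Lp.memLp f).integrable Fact.out) hr hr1) p)

section

variable {p : ℝ} [Fact ((1 : ℝ≥0∞) ≤ ENNReal.ofReal p)] {C : ℝ≥0}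

theorem norm_szegoLM_apply_le
    (hC : ∀ f : T → ℂ, MemLp f (ENNReal.ofReal p) σ → ∀ r : ℝ, 0 ≤ r → r < 1 →
      eLpNorm (fun t => szego f (r * pt t)) (ENNReal.ofReal p) σ
        ≤ C * eLpNorm f (ENNReal.ofReal p) σ) {r : ℝ} (hr : 0 ≤ r) (hr1 : r < 1)
    (f : Lp ℂ (ENNReal.ofReal p) σ) : ‖szegoLM _ r hr hr1 f‖ ≤ C * ‖f‖ := by
  rw [Lp.norm_def, Lp.norm_def, ← ENNReal.coe_toReal, ← ENNReal.toReal_mul,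
    eLpNorm_congr_ae (coeFn_szegoLM hr hr1 f)]
  refine ENNReal.toReal_mono ?_ (hC f (Lp.memLp f) r hr hr1)
  exact ENNReal.mul_ne_top ENNReal.coe_ne_top (Lp.memLp f).eLpNorm_ne_top

/-- The dilated projections are diagonal on characters, so their convergence on trigonometric
polynomials is just rᵏ → 1. -/
theorem szegoLM_fourier {r : ℝ} (hr : 0 ≤ r) (hr1 : r < 1) (k : ℤ) :
    szegoLM (ENNReal.ofReal p) r hr hr1 (fourierLp (ENNReal.ofReal p) k)
      = (if 0 ≤ k then (r : ℂ) ^ k.toNat else 0) • fourierLp (ENNReal.ofReal p) k := by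
  refine Lp.ext ?_
  filter_upwards [coeFn_szegoLM hr hr1 (fourierLp (ENNReal.ofReal p) k),
    coeFn_fourierLp (ENNReal.ofReal p) k,
    Lp.coeFn_smul (if 0 ≤ k then (r : ℂ) ^ k.toNat else 0) (fourierLp (ENNReal.ofReal p) k)]
    with t h1 h2 h3
  have hz : ‖(r : ℂ) * pt t‖ < 1 := by rwa [norm_ofReal_mul_pt hr]
  rw [h1, h3, Pi.smul_apply, h2, szego_congr_ae (coeFn_fourierLp (ENNReal.ofReal p) k)]
  rcases k with k | k
  · rw [if_pos (by simp)]
    refine (szego_fourier_natCast k hz).trans ?_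
    simp [-fourier_apply, fourier_eq_pt_zpow, mul_pow]
  · rw [if_neg (by simp), zero_smul]
    exact szego_fourier_negSucc k hz

/-- The dilated Szegő projections converge strongly as the radius tends to one. -/
theorem cauchySeq_szegoLM
    (hC : ∀ f : T → ℂ, MemLp f (ENNReal.ofReal p) σ → ∀ r : ℝ, 0 ≤ r → r < 1 →
      eLpNorm (fun t => szego f (r * pt t)) (ENNReal.ofReal p) σ
        ≤ C * eLpNorm f (ENNReal.ofReal p) σ) {ρ : ℕ → ℝ} (h0 : ∀ n, 0 ≤ ρ n) (h1 : ∀ n, ρ n < 1)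
    (hρ : Tendsto ρ atTop (𝓝 1)) (f : Lp ℂ (ENNReal.ofReal p) σ) :
    CauchySeq fun n => szegoLM (ENNReal.ofReal p) (ρ n) (h0 n) (h1 n) f := by
  have hspan : ∀ q ∈ Submodule.span ℂ (Set.range (fourierLp (T := 2 * Real.pi)
      (ENNReal.ofReal p))), CauchySeq fun n => szegoLM (ENNReal.ofReal p) (ρ n) (h0 n) (h1 n) q := by
    intro q hq
    induction hq using Submodule.span_induction with
    | mem q hq =>
      obtain ⟨k, rfl⟩ := hq
      refine Tendsto.cauchySeq (x := (if 0 ≤ k then (1 : ℂ) else 0) • fourierLp _ k) ?_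
      simp_rw [szegoLM_fourier]
      refine Tendsto.smul_const ?_ _
      split_ifs
      · have h := ((Complex.continuous_ofReal.tendsto 1).comp hρ).pow k.toNat
        simpa using h
      · exact tendsto_const_nhds
    | zero => simpa using cauchySeq_const 0
    | add x y _ _ hx hy =>
      simp only [map_add]
      exact hx.add hy
    | smul a x _ hx =>
      simp only [map_smul]
      obtain ⟨l, hl⟩ := cauchySeq_tendsto_of_complete hx
      exact (hl.const_smul a).cauchySeq
  have hdense : f ∈ closure (Submodule.span ℂ (Set.range (fourierLp (T := 2 * Real.pi)
      (ENNReal.ofReal p))) : Set (Lp ℂ (ENNReal.ofReal p) σ)) := by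
    rw [← Submodule.topologicalClosure_coe, span_fourierLp_closure_eq_top ENNReal.ofReal_ne_top]
    trivial
  rw [Metric.cauchySeq_iff']
  intro ε hε
  -- C + 1 rather than C, since C may be zero; the uniform operator bound then keeps the images of f
  -- and q within ε/4.
  obtain ⟨q, hq, hfq⟩ := Metric.mem_closure_iff.1 hdense (ε / (4 * (C + 1))) (by positivity)
  obtain ⟨N, hN⟩ := Metric.cauchySeq_iff'.1 (hspan q hq) (ε / 2) (by positivity)
  refine ⟨N, fun n hn => ?_⟩
  have hb : ∀ m, dist (szegoLM (ENNReal.ofReal p) (ρ m) (h0 m) (h1 m) f)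
      (szegoLM (ENNReal.ofReal p) (ρ m) (h0 m) (h1 m) q) ≤ ε / 4 := by
    intro m
    rw [dist_eq_norm, ← map_sub]
    refine (norm_szegoLM_apply_le hC (h0 m) (h1 m) _).trans ?_
    rw [← dist_eq_norm]
    rw [lt_div_iff₀ (by positivity)] at hfq
    nlinarith [dist_nonneg (x := f) (y := q), C.2]
  calc _ ≤ _ := dist_triangle4 _ (szegoLM (ENNReal.ofReal p) (ρ n) (h0 n) (h1 n) q)
        (szegoLM (ENNReal.ofReal p) (ρ N) (h0 N) (h1 N) q) _
    _ < ε / 4 + ε / 2 + ε / 4 := by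
        have h3 := hb N
        rw [dist_comm] at h3
        have := hN n hn
        linarith [hb n]
    _ = ε := by ring

end

/-- For fixed z the kernel is bounded, so `L¹` convergence, implied by `L^p` convergence, suffices.
-/
theorem tendsto_poissonIntegral_of_tendsto_eLpNorm {p : ℝ} (hp : 1 ≤ p) {F : ℕ → T → ℂ}
    {g : T → ℂ} (hF : ∀ n, MemLp (F n) (ENNReal.ofReal p) σ) (hg : MemLp g (ENNReal.ofReal p) σ)
    (h : Tendsto (fun n => eLpNorm (F n - g) (ENNReal.ofReal p) σ) atTop (𝓝 0)) {z : ℂ}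
    (hz : ‖z‖ < 1) :
    Tendsto (fun n => poissonIntegral (F n) z) atTop (𝓝 (poissonIntegral g z)) := by
  obtain ⟨M, hM⟩ := isCompact_univ.exists_bound_of_continuousOn (continuous_poisson hz).continuousOn
  rw [tendsto_iff_edist_tendsto_0]
  refine tendsto_of_tendsto_of_tendsto_of_le_of_le tendsto_const_nhds
    (h := fun n => ENNReal.ofReal M * eLpNorm (F n - g) (ENNReal.ofReal p) σ) ?_
    (fun n => zero_le) fun n => ?_
  · simpa using ENNReal.Tendsto.const_mul h (Or.inr ENNReal.ofReal_ne_top)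
  · have hFi := MemLp.integrable_of_one_le hp (hF n)
    have hgi := MemLp.integrable_of_one_le hp hg
    have e : poissonIntegral (F n) z - poissonIntegral g z
        = poissonIntegral (fun t => F n t - g t) z := by
      simp only [poissonIntegral, mul_sub]
      exact (integral_sub (integrable_poissonIntegral hFi hz)
        (integrable_poissonIntegral hgi hz)).symm
    rw [edist_eq_enorm_sub, e]
    refine (enorm_poissonIntegral_le hz _).trans ?_
    calc ∫⁻ t, ENNReal.ofReal (poisson z t) * ‖F n t - g t‖ₑ ∂σ
        ≤ ∫⁻ t, ENNReal.ofReal M * ‖F n t - g t‖ₑ ∂σ := by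
          refine lintegral_mono fun t => ?_
          gcongr
          exact (le_abs_self _).trans (hM t trivial)
      _ = ENNReal.ofReal M * eLpNorm (F n - g) 1 σ := by
          rw [lintegral_const_mul' _ _ ENNReal.ofReal_ne_top, eLpNorm_one_eq_lintegral_enorm]
          rfl
      _ ≤ _ := mul_le_mul' le_rfl (eLpNorm_le_eLpNorm_of_exponent_le (by simpa using hp)
            ((hF n).sub hg).aestronglyMeasurable)

theorem tendsto_one_sub_one_div : Tendsto (fun n : ℕ => 1 - 1 / ((n : ℝ) + 1)) atTop (𝓝[<] 1) := by
  refine tendsto_nhdsWithin_iff.2 ⟨?_, Eventually.of_forall fun n => ?_⟩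
  · simpa using tendsto_const_nhds.sub (tendsto_one_div_add_atTop_nhds_zero_nat (𝕜 := ℝ))
  · have : (0 : ℝ) < 1 / ((n : ℝ) + 1) := by positivity
    simp only [Set.mem_Iio]; linarith

theorem one_sub_one_div_nonneg (n : ℕ) : 0 ≤ 1 - 1 / ((n : ℝ) + 1) := by
  rw [sub_nonneg, div_le_one (by positivity)]
  linarith [n.cast_nonneg (α := ℝ)]

theorem one_sub_one_div_lt_one (n : ℕ) : 1 - 1 / ((n : ℝ) + 1) < 1 := by
  have : (0 : ℝ) < 1 / ((n : ℝ) + 1) := by positivity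
  linarith

theorem diffContOnCl_dilate {F : ℂ → ℂ} (hF : DifferentiableOn ℂ F (Metric.ball 0 1)) {r : ℝ}
    (hr : 0 ≤ r) (hr1 : r < 1) : DiffContOnCl ℂ (fun z => F (r * z)) (Metric.ball 0 1) := by
  refine DifferentiableOn.diffContOnCl ?_
  rw [closure_ball _ one_ne_zero]
  refine hF.comp (by fun_prop) fun z hz => ?_
  rw [mem_closedBall_zero_iff] at hz
  rw [mem_ball_zero_iff, norm_mul, Complex.norm_real, Real.norm_eq_abs, abs_of_nonneg hr]
  nlinarith [norm_nonneg z]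

theorem tendsto_dilate {F : ℂ → ℂ} (hF : DifferentiableOn ℂ F (Metric.ball 0 1)) {z : ℂ}
    (hz : ‖z‖ < 1) :
    Tendsto (fun n : ℕ => F ((1 - 1 / ((n : ℝ) + 1) : ℝ) * z)) atTop (𝓝 (F z)) := by
  have hz' : z ∈ Metric.ball (0 : ℂ) 1 := by simpa using hz
  have h1 : ContinuousAt F z := (hF.differentiableAt (Metric.isOpen_ball.mem_nhds hz')).continuousAt
  refine h1.tendsto.comp ?_
  have h2 := (Complex.continuous_ofReal.tendsto 1).comp
    (tendsto_one_sub_one_div.mono_right nhdsWithin_le_nhds)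
  simpa using h2.mul_const z

/-- The Szegő projection of an `L^p` function has radial limits almost everywhere, and the
boundary function depends boundedly on `f` in `L^p`. -/
theorem exists_szego_radial_limit {p : ℝ} (hp : 1 < p) :
    ∃ C : ℝ≥0, ∀ f : T → ℂ, MemLp f (ENNReal.ofReal p) σ →
      (⨆ r : Set.Ioo (0 : ℝ) 1,
        eLpNorm (fun t : T => szego f ((r : ℝ) * pt t)) (ENNReal.ofReal p) σ) < ∞ ∧
      ∃ g : T → ℂ, MemLp g (ENNReal.ofReal p) σ ∧
        (∀ᵐ t ∂σ, Tendsto (fun r : ℝ => szego f (r * pt t)) (𝓝[<] 1) (𝓝 (g t))) ∧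
        eLpNorm g (ENNReal.ofReal p) σ ≤ C * eLpNorm f (ENNReal.ofReal p) σ := by
  obtain ⟨C, hC⟩ := exists_eLpNorm_szego_le hp
  have : Fact ((1 : ℝ≥0∞) ≤ ENNReal.ofReal p) := ⟨by simpa using hp.le⟩
  refine ⟨C, fun f hf => ⟨?_, ?_⟩⟩
  · refine lt_of_le_of_lt (iSup_le fun r => hC f hf r r.2.1.le r.2.2) ?_
    exact ENNReal.mul_lt_top ENNReal.coe_lt_top hf.eLpNorm_lt_top
  have hfi := MemLp.integrable_of_one_le hp.le hf
  set ρ : ℕ → ℝ := fun n => 1 - 1 / ((n : ℝ) + 1) with hρ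
  have hρ1 := tendsto_one_sub_one_div
  obtain ⟨G, hG⟩ := cauchySeq_tendsto_of_complete (cauchySeq_szegoLM hC one_sub_one_div_nonneg
    one_sub_one_div_lt_one (hρ1.mono_right nhdsWithin_le_nhds) (hf.toLp f))
  have hcont : ∀ n, Continuous fun t => szego f (ρ n * pt t) := fun n =>
    continuous_szego_mul_pt hfi (one_sub_one_div_nonneg n) (one_sub_one_div_lt_one n)
  have hconv : Tendsto (fun n => eLpNorm ((fun t => szego f (ρ n * pt t)) - (G : T → ℂ))
      (ENNReal.ofReal p) σ) atTop (𝓝 0) := by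
    rw [Lp.tendsto_Lp_iff_tendsto_eLpNorm'] at hG
    refine hG.congr fun n => eLpNorm_congr_ae (EventuallyEq.sub ?_ EventuallyEq.rfl)
    have h1 := coeFn_szegoLM (one_sub_one_div_nonneg n) (one_sub_one_div_lt_one n) (hf.toLp f)
    rwa [szego_congr_ae hf.coeFn_toLp] at h1
  -- Each dilate of Sf is the Poisson integral of its own values on the circle. Letting the radius
  -- tend to 1 identifies Sf with the Poisson integral of the `L^p` limit G.
  have hrep : ∀ z, ‖z‖ < 1 → szego f z = poissonIntegral G z := by
    intro z hz
    have h1 := tendsto_poissonIntegral_of_tendsto_eLpNorm hp.le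
      (fun n => memLp_of_continuous (hcont n) _) (Lp.memLp G) hconv hz
    refine tendsto_nhds_unique (tendsto_dilate (differentiableOn_szego hfi) hz)
      (h1.congr fun n => ?_)
    exact poissonIntegral_of_diffContOnCl (F := fun z => szego f (ρ n * z))
      (diffContOnCl_dilate (differentiableOn_szego hfi) (one_sub_one_div_nonneg n)
        (one_sub_one_div_lt_one n)) hz
  have hlim : ∀ᵐ t ∂σ, Tendsto (fun r : ℝ => szego f (r * pt t)) (𝓝[<] 1) (𝓝 (G t)) := by
    filter_upwards [ae_tendsto_poissonIntegral (MemLp.integrable_of_one_le hp.le (Lp.memLp G))]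
      with t ht
    refine ht.congr' ?_
    filter_upwards [Ioo_mem_nhdsLT (zero_lt_one' ℝ)] with r hr
    rw [hrep]
    rw [norm_ofReal_mul_pt hr.1.le]
    exact hr.2
  refine ⟨G, Lp.memLp G, hlim, ?_⟩
  refine Lp.eLpNorm_le_of_ae_tendsto (u := atTop) (f := fun n t => szego f (ρ n * pt t))
    (Eventually.of_forall fun n => hC f hf _ (one_sub_one_div_nonneg n) (one_sub_one_div_lt_one n))
    (fun n => (hcont n).aestronglyMeasurable) ?_
  filter_upwards [hlim] with t ht
  exact ht.comp hρ1

/-! ### Testing the Campanato seminorm on dyadic arcs -/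

theorem two_inv_pow_rpow (n : ℕ) (s : ℝ) :
    ((2⁻¹ : ℝ≥0∞) ^ n) ^ s = ENNReal.ofReal (((2 : ℝ) ^ (-s)) ^ n) := by
  have h : (2⁻¹ : ℝ≥0∞) = ENNReal.ofReal (2⁻¹) := by
    rw [ENNReal.ofReal_inv_of_pos (by norm_num)]; simp
  rw [h, ← ENNReal.ofReal_pow (by positivity), ENNReal.ofReal_rpow_of_pos (by positivity)]
  congr 1
  rw [← Real.rpow_natCast, ← Real.rpow_natCast, ← Real.rpow_mul (by positivity),
    ← Real.rpow_mul (by positivity), Real.inv_rpow (by positivity), ← Real.rpow_neg (by positivity)]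
  congr 1; ring

theorem eLpNorm_restrict_eq {p : ℝ} (hp : 0 < p) (f : T → ℂ) (s : Set T) :
    eLpNorm f (ENNReal.ofReal p) (σ.restrict s) = (∫⁻ t in s, ‖f t‖ₑ ^ p ∂σ) ^ (1 / p) := by
  rw [eLpNorm_eq_lintegral_rpow_enorm_toReal (by simpa using hp) ENNReal.ofReal_ne_top,
    ENNReal.toReal_ofReal hp.le]

theorem arc_subset_closedBall (c ρ : ℝ) : arc (c - ρ) (c + ρ) ⊆ Metric.closedBall (c : T) ρ := by
  rintro _ ⟨t, ht, rfl⟩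
  rw [Metric.mem_closedBall, dist_eq_norm]
  refine (QuotientAddGroup.norm_mk_le_norm (m := t - c)).trans ?_
  rw [Real.norm_eq_abs, abs_le]
  constructor <;> linarith [ht.1, ht.2]

theorem closedBall_subset_arc_union (c ρ : ℝ) :
    Metric.closedBall (c : T) ρ ⊆ arc (c - ρ) (c + ρ) ∪ {((c - ρ : ℝ) : T)} := by
  intro t ht
  obtain ⟨y, hy, hy'⟩ := exists_coe_eq_abs_eq_norm (t - (c : T))
  rw [Metric.mem_closedBall, dist_eq_norm, ← hy', abs_le] at ht
  have htc : t = ((c + y : ℝ) : T) := by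
    rw [AddCircle.coe_add, hy]; abel
  rcases eq_or_lt_of_le ht.1 with h | h
  · right
    rw [htc, ← h]; rfl
  · left
    exact ⟨c + y, ⟨by linarith, by linarith [ht.2]⟩, htc.symm⟩

theorem measure_singleton_eq_zero (x : T) : σ {x} = 0 := by
  refine le_antisymm (ge_of_tendsto' (ENNReal.tendsto_pow_atTop_nhds_zero_of_lt_one
    (r := 2⁻¹) ?_) fun n => ?_) zero_le
  · rw [ENNReal.inv_lt_one]; exact ENNReal.one_lt_two
  · rw [← measure_dyadicBall x n]
    refine measure_mono (Set.singleton_subset_iff.2 (Metric.mem_closedBall_self ?_))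
    exact div_nonneg Real.pi_pos.le (by positivity)

/-- At most one endpoint distinguishes the half-open arcs of the seminorm from the closed balls of
the dyadic argument. -/
theorem arc_ae_eq_closedBall (c ρ : ℝ) :
    arc (c - ρ) (c + ρ) =ᵐ[σ] Metric.closedBall (c : T) ρ := by
  refine (arc_subset_closedBall c ρ).eventuallyLE.antisymm ?_
  refine (closedBall_subset_arc_union c ρ).eventuallyLE.trans ?_
  exact (union_ae_eq_left_of_ae_eq_empty (ae_eq_empty.2 (measure_singleton_eq_zero _))).le

/-- The Campanato seminorm controls the mean oscillation over dyadic balls. -/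
theorem eLpNorm_sub_mean_dyadicBall_le {p η : ℝ} (hp : 0 < p) (f : T → ℂ) (x : T) (n : ℕ) :
    eLpNorm (fun t => f t - mean f (dyadicBall x n)) (ENNReal.ofReal p)
        (σ.restrict (dyadicBall x n))
      ≤ seminorm p η f * (2⁻¹ ^ n) ^ (η / p) := by
  obtain ⟨c, rfl⟩ := QuotientAddGroup.mk_surjective x
  set ρ := Real.pi / 2 ^ n with hρ
  have hpi := Real.pi_pos
  have hρ0 : 0 < ρ := by positivity
  have hρ1 : ρ ≤ Real.pi := div_le_self hpi.le (one_le_pow₀ (by norm_num))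
  have hr : σ.restrict (arc (c - ρ) (c + ρ)) = σ.restrict (dyadicBall (c : T) n) :=
    Measure.restrict_congr_set (arc_ae_eq_closedBall c ρ)
  have hm : σ (arc (c - ρ) (c + ρ)) = 2⁻¹ ^ n :=
    (measure_congr (arc_ae_eq_closedBall c ρ)).trans (measure_dyadicBall _ n)
  have hmean : mean f (arc (c - ρ) (c + ρ)) = mean f (dyadicBall (c : T) n) := by
    rw [mean, hr]; rfl
  have h : ((∫⁻ t in arc (c - ρ) (c + ρ), ‖f t - mean f (arc (c - ρ) (c + ρ))‖ₑ ^ p ∂σ)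
      / (σ (arc (c - ρ) (c + ρ))) ^ η) ^ (1 / p) ≤ seminorm p η f :=
    le_iSup_of_le (c - ρ) (le_iSup_of_le (c + ρ) (le_iSup_of_le (by linarith)
      (le_iSup_of_le (by linarith) le_rfl)))
  rw [hr, hm, hmean, ENNReal.div_rpow_of_nonneg _ _ (by positivity), ← ENNReal.rpow_mul,
    mul_one_div] at h
  change eLpNorm (fun t => f t - mean f (dyadicBall (c : T) n)) _
    (σ.restrict (dyadicBall (c : T) n)) ≤ _
  rw [eLpNorm_restrict_eq hp]
  refine (ENNReal.div_le_iff ?_ ?_).1 h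
  · rw [two_inv_pow_rpow, Ne, ENNReal.ofReal_eq_zero, not_le]
    positivity
  · rw [two_inv_pow_rpow]; exact ENNReal.ofReal_ne_top

/-- Up to a factor two, the mean is the best constant. -/
theorem eLpNorm_sub_average_le {μ : Measure T} [IsFiniteMeasure μ] {p : ℝ} (hp : 1 ≤ p) {g : T → ℂ}
    (hg : MemLp g (ENNReal.ofReal p) μ) (c : ℂ) :
    eLpNorm (fun t => g t - ⨍ s, g s ∂μ) (ENNReal.ofReal p) μ
      ≤ 2 * eLpNorm (fun t => g t - c) (ENNReal.ofReal p) μ := by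
  rcases eq_or_ne μ 0 with rfl | hμ
  · simp
  have : NeZero μ := ⟨hμ⟩
  have hp0 : 0 < p := by linarith
  have hp1 : (1 : ℝ≥0∞) ≤ ENNReal.ofReal p := by simpa using hp
  have hgi : Integrable g μ := hg.integrable hp1
  have hgc : MemLp (fun t => g t - c) (ENNReal.ofReal p) μ := hg.sub (memLp_const c)
  have hU : μ Set.univ ≠ 0 := by simpa using hμ
  have hU' : μ Set.univ ≠ ∞ := measure_ne_top _ _
  have hav : (⨍ s, g s ∂μ) - c = ⨍ s, (g s - c) ∂μ := by
    rw [average_eq, average_eq, integral_sub hgi (integrable_const c), smul_sub, integral_const,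
      smul_smul, inv_mul_cancel₀, one_smul]
    exact (measureReal_ne_zero_iff hU').2 hU
  -- The average of g - c is bounded by Hölder; the powers of the total mass cancel exactly.
  have hconst : eLpNorm (fun _ : T => (⨍ s, g s ∂μ) - c) (ENNReal.ofReal p) μ
      ≤ eLpNorm (fun t => g t - c) (ENNReal.ofReal p) μ := by
    rw [eLpNorm_const _ (by simpa using hp0) hμ, hav, ENNReal.toReal_ofReal hp0.le]
    have h1 := eLpNorm_le_eLpNorm_mul_rpow_measure_univ hp1 hgc.aestronglyMeasurable
    rw [eLpNorm_one_eq_lintegral_enorm, ENNReal.toReal_one, ENNReal.toReal_ofReal hp0.le] at h1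
    have h2 : ‖⨍ s, (g s - c) ∂μ‖ₑ ≤ (μ Set.univ)⁻¹ * ∫⁻ t, ‖g t - c‖ₑ ∂μ := by
      refine (enorm_integral_le_lintegral_enorm _).trans ?_
      rw [lintegral_smul_measure, smul_eq_mul]
    calc _ ≤ ((μ Set.univ)⁻¹ * (eLpNorm (fun t => g t - c) (ENNReal.ofReal p) μ
          * μ Set.univ ^ (1 / 1 - 1 / p))) * μ Set.univ ^ (1 / p) := by
          gcongr
          exact h2.trans (by gcongr)
      _ = eLpNorm (fun t => g t - c) (ENNReal.ofReal p) μ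
          * ((μ Set.univ)⁻¹ * (μ Set.univ ^ (1 / 1 - 1 / p) * μ Set.univ ^ (1 / p))) := by ring
      _ = _ := by
          rw [← ENNReal.rpow_add _ _ hU hU', div_one, sub_add_cancel, ENNReal.rpow_one,
            ENNReal.inv_mul_cancel hU hU', mul_one]
  have hdec : (fun t => g t - ⨍ s, g s ∂μ)
      = (fun t => g t - c) - fun _ => (⨍ s, g s ∂μ) - c := by
    funext t; simp
  rw [hdec, two_mul (eLpNorm _ _ _)]
  exact (eLpNorm_sub_le hgc.aestronglyMeasurable aestronglyMeasurable_const hp1).trans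
    (by gcongr)

/-- Oscillation bounds over dyadic balls bound the Campanato seminorm. -/
theorem seminorm_le_of_dyadicBall {p η : ℝ} (hp : 1 ≤ p) (hη : 0 < η) {g : T → ℂ}
    (hg : MemLp g (ENNReal.ofReal p) σ) {K : ℝ≥0∞}
    (h : ∀ (x : T) (n : ℕ), ∃ c : ℂ, eLpNorm (fun t => g t - c) (ENNReal.ofReal p)
      (σ.restrict (dyadicBall x n)) ≤ K * (2⁻¹ ^ n) ^ (η / p)) :
    seminorm p η g ≤ 2 * 2 ^ (η / p) * K := by
  have hp0 : 0 < p := by linarith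
  have hpi := Real.pi_pos
  refine iSup_le fun a => iSup_le fun b => iSup_le fun hab => iSup_le fun hb => ?_
  -- The arc lies in the concentric dyadic ball of index n and has more than half its measure. That
  -- ratio costs 2^(η/p); the other factor 2 replaces c by the mean over the arc.
  obtain ⟨n, hn1, hn2⟩ := exists_dyadic_scale (ρ := (b - a) / (2 * Real.pi))
    (div_pos (by linarith) (by positivity)) (by rw [div_le_one (by positivity)]; linarith)
  have harc : arc a b = arc ((a + b) / 2 - (b - a) / 2) ((a + b) / 2 + (b - a) / 2) := by
    congr 1 <;> ring
  have hsub : arc a b ⊆ dyadicBall (((a + b) / 2 : ℝ) : T) n := by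
    rw [harc]
    refine (arc_subset_closedBall _ _).trans (Metric.closedBall_subset_closedBall ?_)
    rw [div_le_iff₀ (by positivity)] at hn2
    rw [div_eq_mul_inv Real.pi, ← inv_pow, ← one_div]
    linarith
  have hmeas : 2⁻¹ ^ (n + 1) ≤ σ (arc a b) := by
    rw [← measure_dyadicBall (((a + b) / 2 : ℝ) : T) (n + 1), harc,
      measure_congr (arc_ae_eq_closedBall _ _)]
    refine measure_mono (Metric.closedBall_subset_closedBall ?_)
    rw [lt_div_iff₀ (by positivity)] at hn1
    rw [div_eq_mul_inv Real.pi, ← inv_pow, ← one_div]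
    linarith
  have hpos : σ (arc a b) ≠ 0 := by
    intro h0
    rw [h0, nonpos_iff_eq_zero] at hmeas
    exact pow_ne_zero _ (by simp) hmeas
  obtain ⟨c, hc⟩ := h (((a + b) / 2 : ℝ) : T) n
  have hηp : 0 ≤ η / p := by positivity
  rw [ENNReal.div_rpow_of_nonneg _ _ (by positivity), ← ENNReal.rpow_mul, mul_one_div,
    ← eLpNorm_restrict_eq hp0 (fun t => g t - mean g (arc a b)), ENNReal.div_le_iff]
  · calc eLpNorm (fun t => g t - mean g (arc a b)) (ENNReal.ofReal p) (σ.restrict (arc a b))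
        ≤ 2 * eLpNorm (fun t => g t - c) (ENNReal.ofReal p) (σ.restrict (arc a b)) :=
          eLpNorm_sub_average_le hp (hg.restrict _) c
      _ ≤ 2 * (K * (2⁻¹ ^ n) ^ (η / p)) := by
          gcongr
          exact (eLpNorm_mono_measure _ (Measure.restrict_mono hsub le_rfl)).trans hc
      _ ≤ 2 * (K * (2 * σ (arc a b)) ^ (η / p)) := by
          gcongr
          calc (2⁻¹ : ℝ≥0∞) ^ n = 2 * 2⁻¹ ^ (n + 1) := by
                rw [pow_succ, mul_left_comm, ENNReal.mul_inv_cancel (by simp) (by simp), mul_one]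
            _ ≤ _ := by gcongr
      _ = _ := by
          rw [ENNReal.mul_rpow_of_nonneg _ _ hηp]; ring
  · exact (ENNReal.rpow_pos (pos_iff_ne_zero.2 hpos) (measure_ne_top _ _)).ne'
  · exact ENNReal.rpow_ne_top_of_nonneg hηp (measure_ne_top _ _)

/-! ### Oscillation and drift of means across dyadic scales -/

/-- After exchanging the sums, the inner one is below 2·2ⁱ; what is left is a geometric series of
ratio 2θ > 1, comparable to its last term. -/
theorem sum_two_pow_mul_sum_pow_le {θ : ℝ} (hθ : 1 / 2 < θ) (n : ℕ) :
    ∑ j ∈ Finset.range n, 2 ^ j * ∑ i ∈ Finset.Ico j n, θ ^ i ≤ 2 / (2 * θ - 1) * (2 * θ) ^ n := by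
  have h0 : 0 < 2 * θ - 1 := by linarith
  have hθ0 : 0 < θ := by linarith
  calc ∑ j ∈ Finset.range n, 2 ^ j * ∑ i ∈ Finset.Ico j n, θ ^ i
      = ∑ i ∈ Finset.range n, ∑ j ∈ Finset.range (i + 1), 2 ^ j * θ ^ i := by
        simp_rw [Finset.mul_sum, Finset.range_eq_Ico]
        exact Finset.sum_Ico_Ico_comm 0 n fun j i => 2 ^ j * θ ^ i
    _ ≤ ∑ i ∈ Finset.range n, 2 * (2 * θ) ^ i := by
        refine Finset.sum_le_sum fun i _ => ?_
        rw [← Finset.sum_mul, geom_sum_eq (by norm_num), mul_pow, ← mul_assoc]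
        gcongr
        rw [pow_succ]; norm_num; linarith
    _ = 2 * (((2 * θ) ^ n - 1) / (2 * θ - 1)) := by
        rw [← Finset.mul_sum, geom_sum_eq (by linarith)]
    _ ≤ _ := by
        rw [div_mul_eq_mul_div, ← mul_div_assoc]
        gcongr
        linarith

theorem norm_mean_dyadicBall_sub_le {f : T → ℂ} (hf : Integrable f σ) (x : T) (n : ℕ) (c : ℂ) :
    ‖mean f (dyadicBall x n) - c‖ ≤ 2 ^ n * ∫ t in dyadicBall x n, ‖f t - c‖ ∂σ := by
  have hm : σ.real (dyadicBall x n) = (2 ^ n)⁻¹ := by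
    rw [Measure.real, measure_dyadicBall]; simp
  have h : mean f (dyadicBall x n) - c = (2 ^ n : ℝ) • ∫ t in dyadicBall x n, (f t - c) ∂σ := by
    rw [mean, setAverage_eq, hm, inv_inv, integral_sub hf.integrableOn (integrable_const c),
      setIntegral_const, hm, smul_sub, smul_smul, mul_inv_cancel₀ (by positivity), one_smul]
  rw [h, norm_smul, Real.norm_eq_abs, abs_of_pos (by positivity)]
  gcongr
  exact norm_integral_le_integral_norm _

/-- The `L¹` mean oscillation over dyadic balls. -/
theorem dyadic_average_sub_mean_le {p η : ℝ} (hp : 1 ≤ p) {f : T → ℂ}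
    (hf : MemCampanato p η f) (x : T) (n : ℕ) :
    2 ^ n * ∫ t in dyadicBall x n, ‖f t - mean f (dyadicBall x n)‖ ∂σ
      ≤ (seminorm p η f).toReal * ((2 : ℝ) ^ ((1 - η) / p)) ^ n := by
  have hp0 : 0 < p := by linarith
  have hfi := MemLp.integrable_of_one_le hp hf.1
  set m := mean f (dyadicBall x n)
  have hsub : Integrable (fun t => f t - m) σ := hfi.sub (integrable_const m)
  -- Hölder on the arc; the exponents combine as 1 - η/p - (1 - 1/p) = (1-η)/p.
  have h1 := eLpNorm_le_eLpNorm_mul_rpow_measure_univ (μ := σ.restrict (dyadicBall x n))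
    (p := 1) (q := ENNReal.ofReal p) (by simpa using hp) hsub.aestronglyMeasurable.restrict
  have h2 := eLpNorm_sub_mean_dyadicBall_le (η := η) hp0 f x n
  rw [Measure.restrict_apply_univ, measure_dyadicBall, eLpNorm_one_eq_lintegral_enorm,
    ENNReal.toReal_one, ENNReal.toReal_ofReal hp0.le,
    ← ofReal_integral_norm_eq_lintegral_enorm hsub.integrableOn] at h1
  have h3 := h1.trans (mul_le_mul_left h2 _)
  rw [mul_assoc, two_inv_pow_rpow, two_inv_pow_rpow, ← ENNReal.ofReal_toReal hf.2.ne,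
    ← ENNReal.ofReal_mul (by positivity), ← ENNReal.ofReal_mul (by positivity),
    ENNReal.ofReal_le_ofReal_iff (by positivity)] at h3
  refine (mul_le_mul_of_nonneg_left h3 (by positivity : (0 : ℝ) ≤ 2 ^ n)).trans (le_of_eq ?_)
  rw [mul_left_comm, ← mul_pow, ← mul_pow]
  congr 2
  rw [← Real.rpow_add (by norm_num)]
  nth_rewrite 1 [← Real.rpow_one 2]
  rw [← Real.rpow_add (by norm_num)]
  congr 1
  field_simp
  ring

/-- The smaller arc is half of the larger one, so averaging over it costs a factor 2. -/
theorem norm_mean_succ_sub_mean_le {p η : ℝ} (hp : 1 ≤ p) {f : T → ℂ}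
    (hf : MemCampanato p η f) (x : T) (n : ℕ) :
    ‖mean f (dyadicBall x (n + 1)) - mean f (dyadicBall x n)‖
      ≤ 2 * (seminorm p η f).toReal * ((2 : ℝ) ^ ((1 - η) / p)) ^ n := by
  have hfi := MemLp.integrable_of_one_le hp hf.1
  have hsub : Integrable (fun t => f t - mean f (dyadicBall x n)) σ :=
    hfi.sub (integrable_const _)
  refine (norm_mean_dyadicBall_sub_le hfi x (n + 1) _).trans ?_
  have h1 : ∫ t in dyadicBall x (n + 1), ‖f t - mean f (dyadicBall x n)‖ ∂σ
      ≤ ∫ t in dyadicBall x n, ‖f t - mean f (dyadicBall x n)‖ ∂σ :=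
    setIntegral_mono_set hsub.norm.integrableOn (Eventually.of_forall fun t => norm_nonneg _)
      (dyadicBall_anti x n.le_succ).eventuallyLE
  calc _ ≤ 2 ^ (n + 1) * ∫ t in dyadicBall x n, ‖f t - mean f (dyadicBall x n)‖ ∂σ := by gcongr
    _ = 2 * (2 ^ n * ∫ t in dyadicBall x n, ‖f t - mean f (dyadicBall x n)‖ ∂σ) := by
        rw [pow_succ]; ring
    _ ≤ 2 * ((seminorm p η f).toReal * ((2 : ℝ) ^ ((1 - η) / p)) ^ n) :=
        mul_le_mul_of_nonneg_left (dyadic_average_sub_mean_le hp hf x n) (by norm_num)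
    _ = _ := by ring

/-- The oscillation over a dyadic ball about the mean over a smaller one. -/
theorem dyadic_average_sub_mean_le_sum {p η : ℝ} (hp : 1 ≤ p) {f : T → ℂ}
    (hf : MemCampanato p η f) (x : T) (j k : ℕ) :
    2 ^ j * ∫ t in dyadicBall x j, ‖f t - mean f (dyadicBall x (j + k))‖ ∂σ
      ≤ 3 * (seminorm p η f).toReal
        * ∑ i ∈ Finset.Ico j (j + k + 1), ((2 : ℝ) ^ ((1 - η) / p)) ^ i := by
  set θ := (2 : ℝ) ^ ((1 - η) / p)
  set N := (seminorm p η f).toReal with hN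
  have hN0 : 0 ≤ N := ENNReal.toReal_nonneg
  have hθ : 0 < θ := by positivity
  have hfi := MemLp.integrable_of_one_le hp hf.1
  have hint : ∀ c, IntegrableOn (fun t => ‖f t - c‖) (dyadicBall x j) σ := fun c =>
    (hfi.sub (integrable_const c)).norm.integrableOn
  -- For the induction the initial oscillation is kept apart from the jumps of the means; merging
  -- them gives 3 = 1 + 2. The sum stays unevaluated because θ may lie on either side of 1 or equal
  -- it.
  suffices hk : 2 ^ j * ∫ t in dyadicBall x j, ‖f t - mean f (dyadicBall x (j + k))‖ ∂σ
      ≤ N * θ ^ j + 2 * N * ∑ i ∈ Finset.Ico j (j + k), θ ^ i by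
    have h1 : θ ^ j ≤ ∑ i ∈ Finset.Ico j (j + k + 1), θ ^ i :=
      Finset.single_le_sum (f := fun i => θ ^ i) (fun i _ => by positivity) (by simp)
    have h2 : ∑ i ∈ Finset.Ico j (j + k), θ ^ i ≤ ∑ i ∈ Finset.Ico j (j + k + 1), θ ^ i :=
      Finset.sum_le_sum_of_subset_of_nonneg (Finset.Ico_subset_Ico_right (by omega))
        fun i _ _ => by positivity
    nlinarith
  induction k with
  | zero => simpa using dyadic_average_sub_mean_le hp hf x j
  | succ k ih =>
    have h := norm_mean_succ_sub_mean_le hp hf x (j + k)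
    rw [← add_assoc, Finset.sum_Ico_succ_top (by omega), mul_add, ← add_assoc (N * θ ^ j)]
    have hm : σ.real (dyadicBall x j) = (2 ^ j)⁻¹ := by
      rw [Measure.real, measure_dyadicBall]; simp
    set m := mean f (dyadicBall x (j + k))
    set m' := mean f (dyadicBall x (j + k + 1))
    have h1 : ∫ t in dyadicBall x j, ‖f t - m'‖ ∂σ
        ≤ (∫ t in dyadicBall x j, ‖f t - m‖ ∂σ) + (2 ^ j)⁻¹ * ‖m' - m‖ := by
      calc _ ≤ ∫ t in dyadicBall x j, (‖f t - m‖ + ‖m' - m‖) ∂σ := by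
            refine integral_mono (hint m') ((hint m).add (integrable_const _)) fun t => ?_
            have := norm_sub_le (f t - m) (m' - m)
            simpa using this
        _ = _ := by
            rw [integral_add (hint m) (integrable_const _), setIntegral_const, hm, smul_eq_mul]
    calc 2 ^ j * ∫ t in dyadicBall x j, ‖f t - m'‖ ∂σ
        ≤ 2 ^ j * ((∫ t in dyadicBall x j, ‖f t - m‖ ∂σ) + (2 ^ j)⁻¹ * ‖m' - m‖) := by gcongr
      _ = 2 ^ j * (∫ t in dyadicBall x j, ‖f t - m‖ ∂σ) + ‖m' - m‖ := by
          rw [mul_add, mul_inv_cancel_left₀ (by positivity)]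
      _ ≤ _ := add_le_add ih h

/-! ### The far part and the local estimate for the Szegő projection -/

/-- Smoothness of the Cauchy kernel away from the singularity. -/
theorem norm_inv_sub_inv_le {x s s' t : T} {r : ℝ} (hr : 0 ≤ r) (hr1 : r < 1) {n j : ℕ}
    (hj : j + 1 < n) (hs : s ∈ dyadicBall x n) (hs' : s' ∈ dyadicBall x n)
    (ht : t ∉ dyadicBall x (j + 1)) :
    ‖(1 - (r : ℂ) * pt s * conj (pt t))⁻¹ - (1 - (r : ℂ) * pt s' * conj (pt t))⁻¹‖
      ≤ 32 * Real.pi * 4 ^ j / 2 ^ n := by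
  have hpi := Real.pi_pos
  have hne : ∀ s : T, 1 - (r : ℂ) * pt s * conj (pt t) ≠ 0 := fun s =>
    one_sub_mul_conj_pt_ne_zero (by rwa [norm_ofReal_mul_pt hr]) t
  rw [dyadicBall, Metric.mem_closedBall] at hs hs' ht
  rw [not_le] at ht
  -- The gap j + 2 ≤ n is essential: s lies within π/2^(j+2) of x and t beyond twice that, so they
  -- stay π/2^(j+2) apart.
  have hn : Real.pi / 2 ^ n ≤ Real.pi / 2 ^ (j + 2) := by
    gcongr
    · norm_num
    · omega
  have hlow : ∀ s : T, dist s x ≤ Real.pi / 2 ^ n →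
      1 / 2 ^ (j + 2) ≤ ‖1 - (r : ℂ) * pt s * conj (pt t)‖ := by
    intro s hs
    rw [norm_one_sub_mul_conj_pt]
    have h1 := dist_le_norm_pt_sub_mul_pt s t hr hr1.le
    have h2 := dist_triangle t s x
    have h3 : Real.pi / 2 ^ (j + 1) = 2 * (Real.pi / 2 ^ (j + 2)) := by
      rw [pow_succ (2 : ℝ) (j + 1)]; field_simp
    have h4 : Real.pi * (1 / 2 ^ (j + 2)) ≤ Real.pi * ‖pt t - r * pt s‖ := by
      rw [mul_one_div]; linarith
    exact le_of_mul_le_mul_left h4 hpi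
  have hnum : ‖(r : ℂ) * pt s * conj (pt t) - r * pt s' * conj (pt t)‖ ≤ 2 * (Real.pi / 2 ^ n) := by
    rw [← sub_mul, ← mul_sub, norm_mul, norm_mul, RCLike.norm_conj, norm_pt, mul_one,
      Complex.norm_real, Real.norm_eq_abs, abs_of_nonneg hr]
    have h1 := norm_pt_sub_pt_le s s'
    have h2 := dist_triangle_right s s' x
    nlinarith [norm_nonneg (pt s - pt s')]
  rw [inv_sub_inv (hne s) (hne s'), norm_div, norm_mul]
  have e : 1 - (r : ℂ) * pt s' * conj (pt t) - (1 - (r : ℂ) * pt s * conj (pt t))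
      = (r : ℂ) * pt s * conj (pt t) - r * pt s' * conj (pt t) := by ring
  rw [e]
  calc _ ≤ 2 * (Real.pi / 2 ^ n) / (1 / 2 ^ (j + 2) * (1 / 2 ^ (j + 2))) := by
        gcongr
        · exact hlow s hs
        · exact hlow s' hs'
    _ = _ := by
        have : (4 : ℝ) ^ j = 2 ^ j * 2 ^ j := by rw [← mul_pow]; norm_num
        rw [this, pow_add]; field_simp; norm_num

/-- The part of `f` away from `x` contributes a function of small oscillation near `x`. -/
theorem norm_szego_sub_szego_le {p η : ℝ} (hp : 1 < p) (hη2 : η < 2) {f : T → ℂ}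
    (hf : MemCampanato p η f) (x : T) (n : ℕ) {r : ℝ} (hr : 0 ≤ r) (hr1 : r < 1) {s s' : T}
    (hs : s ∈ dyadicBall x (n + 1)) (hs' : s' ∈ dyadicBall x (n + 1)) :
    ‖szego ((dyadicBall x n)ᶜ.indicator fun t => f t - mean f (dyadicBall x n)) (r * pt s)
      - szego ((dyadicBall x n)ᶜ.indicator fun t => f t - mean f (dyadicBall x n)) (r * pt s')‖
      ≤ 192 * Real.pi / (2 * (2 : ℝ) ^ ((1 - η) / p) - 1) * (seminorm p η f).toReal
        * ((2 : ℝ) ^ ((1 - η) / p)) ^ (n + 1) := by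
  set θ := (2 : ℝ) ^ ((1 - η) / p) with hθdef
  set N := (seminorm p η f).toReal with hN
  set m := mean f (dyadicBall x n) with hm
  have hpi := Real.pi_pos
  have hN0 : 0 ≤ N := ENNReal.toReal_nonneg
  have hp0 : 0 < p := by linarith
  -- Equivalent to η < 1 + p, which the chain η < 2 < 1 + p supplies.
  have hθ : 1 / 2 < θ := by
    have h1 : (1 / 2 : ℝ) = 2 ^ (-1 : ℝ) := by
      rw [Real.rpow_neg_one]; norm_num
    rw [h1, hθdef]
    apply Real.rpow_lt_rpow_of_exponent_lt (by norm_num)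
    rw [lt_div_iff₀ hp0]; linarith
  have hθ1 : 0 < 2 * θ - 1 := by linarith
  have hfi := MemLp.integrable_of_one_le hp.le hf.1
  have hsub : Integrable (fun t => f t - m) σ := hfi.sub (integrable_const m)
  have hB := measurableSet_dyadicBall x n
  set h2 : T → ℂ := (dyadicBall x n)ᶜ.indicator fun t => f t - m with hh2
  have h2i : Integrable h2 σ := hsub.indicator hB.compl
  have hz : ∀ s : T, ‖(r : ℂ) * pt s‖ < 1 := fun s => by rwa [norm_ofReal_mul_pt hr]
  -- The cutoff removes the innermost arc. With s and s' in the arc of index n + 1, every remaining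
  -- annulus j < n satisfies the separation required by `norm_inv_sub_inv_le`.
  set K : T → ℝ≥0∞ := (dyadicBall x n)ᶜ.indicator fun t =>
    ‖(1 - (r : ℂ) * pt s * conj (pt t))⁻¹ - (1 - (r : ℂ) * pt s' * conj (pt t))⁻¹‖ₑ with hK
  have hdiff : ‖szego h2 (r * pt s) - szego h2 (r * pt s')‖ₑ
      ≤ ∫⁻ t, K t * ‖f t - m‖ₑ ∂σ := by
    rw [szego, szego, ← integral_sub (integrable_szego h2i (hz s)) (integrable_szego h2i (hz s'))]
    refine (enorm_integral_le_lintegral_enorm _).trans (lintegral_mono fun t => ?_)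
    by_cases ht : t ∈ (dyadicBall x n)ᶜ
    · simp only [hK, hh2, Set.indicator_of_mem ht, div_eq_mul_inv]
      rw [← mul_sub, enorm_mul, mul_comm]
    · simp [hK, hh2, Set.indicator_of_notMem ht]
  have hdy := lintegral_mul_le_sum_dyadicBall x n (K := K) (φ := fun t => ‖f t - m‖ₑ)
    (M := fun j => ENNReal.ofReal (32 * Real.pi * 4 ^ j / 2 ^ (n + 1)))
    hsub.aestronglyMeasurable.enorm
    (fun t ht => by
      rw [hK, Set.indicator_of_notMem (by simpa using ht)]; exact zero_le)
    (fun j hj t ht => by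
      have ht' : t ∈ (dyadicBall x n)ᶜ := fun h => ht (dyadicBall_anti x hj h)
      rw [hK, Set.indicator_of_mem ht', ← ofReal_norm]
      exact ENNReal.ofReal_le_ofReal (norm_inv_sub_inv_le hr hr1 (by omega) hs hs' ht))
  have hsum : ∑ j ∈ Finset.range (n + 1), ENNReal.ofReal (32 * Real.pi * 4 ^ j / 2 ^ (n + 1))
        * ∫⁻ t in dyadicBall x j, ‖f t - m‖ₑ ∂σ
      ≤ ENNReal.ofReal (∑ j ∈ Finset.range (n + 1), 96 * Real.pi * N / 2 ^ (n + 1)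
        * (2 ^ j * ∑ i ∈ Finset.Ico j (n + 1), θ ^ i)) := by
    rw [ENNReal.ofReal_sum_of_nonneg]
    · refine Finset.sum_le_sum fun j hj => ?_
      rw [← ofReal_integral_norm_eq_lintegral_enorm hsub.integrableOn,
        ← ENNReal.ofReal_mul (by positivity)]
      refine ENNReal.ofReal_le_ofReal ?_
      obtain ⟨k, rfl⟩ := Nat.exists_eq_add_of_le (Nat.lt_succ_iff.1 (Finset.mem_range.1 hj))
      have h4 := dyadic_average_sub_mean_le_sum hp.le hf x j k
      have : (4 : ℝ) ^ j = 2 ^ j * 2 ^ j := by rw [← mul_pow]; norm_num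
      calc 32 * Real.pi * 4 ^ j / 2 ^ (j + k + 1) * ∫ t in dyadicBall x j, ‖f t - m‖ ∂σ
          = 32 * Real.pi / 2 ^ (j + k + 1) * 2 ^ j
            * (2 ^ j * ∫ t in dyadicBall x j, ‖f t - m‖ ∂σ) := by rw [this]; ring
        _ ≤ 32 * Real.pi / 2 ^ (j + k + 1) * 2 ^ j
            * (3 * N * ∑ i ∈ Finset.Ico j (j + k + 1), θ ^ i) := by gcongr
        _ = _ := by ring
    · intro j _
      have : 0 ≤ ∑ i ∈ Finset.Ico j (n + 1), θ ^ i := Finset.sum_nonneg fun i _ => by positivity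
      positivity
  have hfin := hdiff.trans (hdy.trans hsum)
  rw [← ofReal_norm, ← Finset.mul_sum, ENNReal.ofReal_le_ofReal_iff] at hfin
  · refine hfin.trans ?_
    calc _ ≤ 96 * Real.pi * N / 2 ^ (n + 1) * (2 / (2 * θ - 1) * (2 * θ) ^ (n + 1)) := by
          gcongr
          exact sum_two_pow_mul_sum_pow_le hθ (n + 1)
      _ = _ := by
          rw [mul_pow]; field_simp; ring
  · refine mul_nonneg (by positivity) (Finset.sum_nonneg fun j _ => ?_)
    exact mul_nonneg (by positivity) (Finset.sum_nonneg fun i _ => by positivity)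

theorem eventually_mem_Ioo_zero_one : ∀ᶠ r : ℝ in 𝓝[<] 1, r ∈ Set.Ioo (0 : ℝ) 1 :=
  Ioo_mem_nhdsLT zero_lt_one

/-- The boundary function of the Szegő projection of a Campanato function: existence, `L^p` bound,
and mean oscillation over dyadic balls. -/
theorem exists_szego_oscillation_le {p η : ℝ} (hp : 1 < p) (hη2 : η < 2) :
    ∃ K : ℝ≥0, ∀ f : T → ℂ, MemCampanato p η f →
      MemHardy p (szego f) ∧
      ∃ g : T → ℂ, MemLp g (ENNReal.ofReal p) σ ∧
        (∀ᵐ t ∂σ, Tendsto (fun r : ℝ => szego f (r * pt t)) (𝓝[<] 1) (𝓝 (g t))) ∧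
        eLpNorm g (ENNReal.ofReal p) σ ≤ K * norm p η f ∧
        ∀ (x : T) (n : ℕ), ∃ c : ℂ, eLpNorm (fun t => g t - c) (ENNReal.ofReal p)
          (σ.restrict (dyadicBall x n)) ≤ (K * norm p η f) * (2⁻¹ ^ n) ^ (η / p) := by
  obtain ⟨C, hC⟩ := exists_szego_radial_limit hp
  have hp0 : 0 < p := by linarith
  have hp1 : (1 : ℝ≥0∞) ≤ ENNReal.ofReal p := by simpa using hp.le
  set θ := (2 : ℝ) ^ ((1 - η) / p) with hθ
  set A : ℝ := 192 * Real.pi / (2 * θ - 1) with hA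
  set D : ℝ≥0 := Real.toNNReal ((2 : ℝ) ^ (η / p)) with hD
  -- C serves the global `L^p` bound, C·D the local part and A the far part; D is the price of
  -- comparing arcs of index n and n + 1.
  refine ⟨C + C * D + Real.toNNReal A, fun f hf => ?_⟩
  have hfi := MemLp.integrable_of_one_le hp.le hf.1
  obtain ⟨hsup, g, hg, hlim, hle⟩ := hC f hf.1
  have hfn : eLpNorm f (ENNReal.ofReal p) σ ≤ norm p η f := le_self_add
  have hsn : seminorm p η f ≤ norm p η f := le_add_self
  have hgle : eLpNorm g (ENNReal.ofReal p) σ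
      ≤ ((C + C * D + Real.toNNReal A : ℝ≥0) : ℝ≥0∞) * norm p η f := by
    refine hle.trans ?_
    gcongr
    rw [add_assoc]; exact le_self_add
  refine ⟨⟨differentiableOn_szego hfi, hsup⟩, g, hg, hlim, hgle, fun x n => ?_⟩
  -- The whole circle has no larger arc to localize to; there the `L^p` bound with c = 0 suffices.
  rcases n with _ | n
  · refine ⟨0, ?_⟩
    simpa [dyadicBall_zero] using hgle
  set B := dyadicBall x n with hB
  set B' := dyadicBall x (n + 1) with hB'
  set m := mean f B with hm
  have hBm : MeasurableSet B := measurableSet_dyadicBall x n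
  have hsub : MemLp (fun t => f t - m) (ENNReal.ofReal p) σ := hf.1.sub (memLp_const m)
  have hm1 : MemLp (B.indicator fun t => f t - m) (ENNReal.ofReal p) σ := hsub.indicator hBm
  have hm2 : MemLp (Bᶜ.indicator fun t => f t - m) (ENNReal.ofReal p) σ :=
    hsub.indicator hBm.compl
  have hosc : ∀ r : ℝ, 0 ≤ r → r < 1 → ∀ s ∈ B', ∀ s' ∈ B',
      ‖szego (Bᶜ.indicator fun t => f t - m) (r * pt s)
        - szego (Bᶜ.indicator fun t => f t - m) (r * pt s')‖
      ≤ A * (seminorm p η f).toReal * θ ^ (n + 1) := fun r hr hr1 s hs s' hs' =>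
    norm_szego_sub_szego_le hp hη2 hf x n hr hr1 hs hs'
  obtain ⟨-, g1, hg1, hlim1, hle1⟩ := hC _ hm1
  obtain ⟨-, g2, hg2, hlim2, -⟩ := hC _ hm2
  set h1 : T → ℂ := B.indicator fun t => f t - m with hh1
  set h2 : T → ℂ := Bᶜ.indicator fun t => f t - m with hh2
  have hi1 := MemLp.integrable_of_one_le hp.le hm1
  have hi2 := MemLp.integrable_of_one_le hp.le hm2
  have hdec : ∀ z, ‖z‖ < 1 → szego f z = m + (szego h1 z + szego h2 z) := by
    intro z hz
    have e : f = fun t => m + (h1 t + h2 t) := by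
      funext t
      have := congrFun (Set.indicator_self_add_compl B fun t => f t - m) t
      simp only [Pi.add_apply] at this
      rw [hh1, hh2, this]; ring
    conv_lhs => rw [e]
    rw [szego_add (f := fun _ => m) (g := fun t => h1 t + h2 t) (integrable_const m)
      (hi1.add hi2) hz, szego_add hi1 hi2 hz, szego_const m hz]
  have hsum : ∀ᵐ t ∂σ, g t = m + (g1 t + g2 t) := by
    filter_upwards [hlim, hlim1, hlim2] with t a b c
    refine tendsto_nhds_unique a (((b.add c).const_add m).congr' ?_)
    filter_upwards [eventually_mem_Ioo_zero_one] with r hr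
    rw [hdec]
    rw [norm_ofReal_mul_pt hr.1.le]; exact hr.2
  have hB'm : MeasurableSet B' := measurableSet_dyadicBall x (n + 1)
  have hne : σ.restrict B' ≠ 0 := by
    rw [Ne, Measure.restrict_eq_zero, measure_dyadicBall]
    exact pow_ne_zero _ (by simp)
  have hNB : (ae (σ.restrict B')).NeBot := ae_neBot.2 hne
  -- A reference point of the arc where S h₂ has its radial limit g₂(s'); the comparison constant is
  -- m + g₂(s').
  obtain ⟨s', hs', hlims'⟩ := ((ae_restrict_mem hB'm).and (ae_restrict_of_ae hlim2)).exists
  have hosc2 : ∀ᵐ t ∂σ.restrict B', ‖g2 t - g2 s'‖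
      ≤ A * (seminorm p η f).toReal * θ ^ (n + 1) := by
    filter_upwards [ae_restrict_mem hB'm, ae_restrict_of_ae hlim2] with t ht hlt
    refine le_of_tendsto (hlt.sub hlims').norm ?_
    filter_upwards [eventually_mem_Ioo_zero_one] with r hr
    exact hosc r hr.1.le hr.2 t ht s' hs'
  refine ⟨m + g2 s', ?_⟩
  have hcongr : (fun t => g t - (m + g2 s')) =ᵐ[σ.restrict B'] g1 + fun t => g2 t - g2 s' := by
    filter_upwards [ae_restrict_of_ae hsum] with t ht
    rw [Pi.add_apply, ht]; ring
  rw [eLpNorm_congr_ae hcongr]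
  refine (eLpNorm_add_le hg1.aestronglyMeasurable.restrict
    (hg2.sub (memLp_const _)).aestronglyMeasurable.restrict hp1).trans ?_
  have hDr : ((2⁻¹ : ℝ≥0∞) ^ n) ^ (η / p) = D * (2⁻¹ ^ (n + 1)) ^ (η / p) := by
    rw [two_inv_pow_rpow, two_inv_pow_rpow, hD]
    change _ = ENNReal.ofReal _ * _
    rw [← ENNReal.ofReal_mul (by positivity), pow_succ, mul_left_comm,
      ← Real.rpow_add (by norm_num), add_neg_cancel, Real.rpow_zero, mul_one]
  have hpart1 : eLpNorm g1 (ENNReal.ofReal p) (σ.restrict B')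
      ≤ (C * D * norm p η f) * (2⁻¹ ^ (n + 1)) ^ (η / p) := by
    calc _ ≤ eLpNorm g1 (ENNReal.ofReal p) σ := eLpNorm_mono_measure _ Measure.restrict_le_self
      _ ≤ C * eLpNorm h1 (ENNReal.ofReal p) σ := hle1
      _ ≤ C * (norm p η f * (2⁻¹ ^ n) ^ (η / p)) := by
          rw [hh1, eLpNorm_indicator_eq_eLpNorm_restrict hBm]
          gcongr
          exact (eLpNorm_sub_mean_dyadicBall_le (η := η) hp0 f x n).trans (by gcongr)
      _ = _ := by rw [hDr]; ring
  have hpart2 : eLpNorm (fun t => g2 t - g2 s') (ENNReal.ofReal p) (σ.restrict B')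
      ≤ (ENNReal.ofReal A * norm p η f) * (2⁻¹ ^ (n + 1)) ^ (η / p) := by
    refine (eLpNorm_le_of_ae_bound hosc2).trans ?_
    rw [Measure.restrict_apply_univ, measure_dyadicBall, ENNReal.toReal_ofReal hp0.le,
      ENNReal.ofReal_mul' (by positivity), ENNReal.ofReal_mul' ENNReal.toReal_nonneg,
      ENNReal.ofReal_toReal hf.2.ne]
    -- A pointwise oscillation of order θ^(n+1), times the `L^p` size of the arc's indicator, is
    -- exactly the Campanato rate.
    have e : (2⁻¹ ^ (n + 1)) ^ p⁻¹ * ENNReal.ofReal (θ ^ (n + 1)) = (2⁻¹ ^ (n + 1)) ^ (η / p) := by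
      rw [two_inv_pow_rpow, two_inv_pow_rpow, ← ENNReal.ofReal_mul (by positivity), ← mul_pow, hθ,
        ← Real.rpow_add (by norm_num)]
      congr 4
      field_simp; ring
    calc _ = (ENNReal.ofReal A * seminorm p η f)
          * ((2⁻¹ ^ (n + 1)) ^ p⁻¹ * ENNReal.ofReal (θ ^ (n + 1))) := by ring
      _ ≤ _ := by rw [e]; gcongr
  refine (add_le_add hpart1 hpart2).trans ?_
  rw [← add_mul, ← add_mul]
  gcongr
  push_cast
  rw [add_assoc]
  exact le_add_self

/-! ### Boundedness of the Szegő projection and of the conjugate operator -/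

theorem seminorm_congr_ae {p η : ℝ} {f g : T → ℂ} (h : f =ᵐ[σ] g) :
    seminorm p η f = seminorm p η g := by
  have key : ∀ a b : ℝ, ∫⁻ t in arc a b, ‖f t - mean f (arc a b)‖ₑ ^ p ∂σ
      = ∫⁻ t in arc a b, ‖g t - mean g (arc a b)‖ₑ ^ p ∂σ := by
    intro a b
    have hm : mean f (arc a b) = mean g (arc a b) := average_congr (ae_restrict_of_ae h)
    refine lintegral_congr_ae ?_
    filter_upwards [ae_restrict_of_ae h] with t ht
    rw [ht, hm]
  simp only [seminorm, key]

theorem norm_congr_ae {p η : ℝ} {f g : T → ℂ} (h : f =ᵐ[σ] g) : norm p η f = norm p η g := by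
  rw [norm, norm, eLpNorm_congr_ae h, seminorm_congr_ae h]

theorem boundary_ae_eq {F : ℂ → ℂ} {g : T → ℂ}
    (h : ∀ᵐ t ∂σ, Tendsto (fun r : ℝ => F (r * pt t)) (𝓝[<] 1) (𝓝 (g t))) :
    boundary F =ᵐ[σ] g := by
  filter_upwards [h] with t ht
  exact ht.limUnder_eq

theorem norm_le_of_dyadicBall {p η : ℝ} (hp : 1 ≤ p) (hη : 0 < η) {g : T → ℂ} {K : ℝ≥0∞}
    (hg : MemLp g (ENNReal.ofReal p) σ) (hgK : eLpNorm g (ENNReal.ofReal p) σ ≤ K)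
    (h : ∀ (x : T) (n : ℕ), ∃ c : ℂ, eLpNorm (fun t => g t - c) (ENNReal.ofReal p)
      (σ.restrict (dyadicBall x n)) ≤ K * (2⁻¹ ^ n) ^ (η / p)) :
    norm p η g ≤ (1 + 2 * 2 ^ (η / p)) * K := by
  rw [norm, add_mul, one_mul]
  exact add_le_add hgK (seminorm_le_of_dyadicBall hp hη hg h)

theorem memCampanato_of_norm_lt_top {p η : ℝ} {g : T → ℂ}
    (hg : AEStronglyMeasurable g σ) (h : norm p η g < ∞) : MemCampanato p η g :=
  ⟨⟨hg, (le_self_add.trans_lt h)⟩, (le_add_self.trans_lt h)⟩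

theorem MemCampanato.norm_lt_top {p η : ℝ} {g : T → ℂ} (h : MemCampanato p η g) :
    norm p η g < ∞ :=
  ENNReal.add_lt_top.2 ⟨h.1.eLpNorm_lt_top, h.2⟩

theorem MemCampanato.congr_ae {p η : ℝ} {f g : T → ℂ} (hf : MemCampanato p η f)
    (h : f =ᵐ[σ] g) : MemCampanato p η g :=
  ⟨hf.1.ae_eq h, by rw [← seminorm_congr_ae h]; exact hf.2⟩

theorem exists_coe_eq_one_add_two_mul_rpow (s : ℝ) :
    ∃ L : ℝ≥0, (L : ℝ≥0∞) = 1 + 2 * 2 ^ s := by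
  refine ⟨(1 + 2 * (2 : ℝ≥0∞) ^ s).toNNReal, ENNReal.coe_toNNReal ?_⟩
  refine ENNReal.add_ne_top.2 ⟨ENNReal.one_ne_top, ENNReal.mul_ne_top (by simp) ?_⟩
  exact ENNReal.rpow_ne_top_of_ne_zero (by simp) (by simp)

/-- The Szegő projection is bounded from the Campanato space to the analytic Campanato space. -/
theorem exists_norm_boundary_szego_le {p η : ℝ} (hp : 1 < p) (hη : 0 < η) (hη2 : η < 2) :
    ∃ C : ℝ≥0, ∀ f : T → ℂ, MemCampanato p η f →
      MemAnalyticCampanato p η (szego f) ∧ norm p η (boundary (szego f)) ≤ C * norm p η f := by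
  obtain ⟨K, hK⟩ := exists_szego_oscillation_le hp hη2
  obtain ⟨L, hL⟩ := exists_coe_eq_one_add_two_mul_rpow (η / p)
  refine ⟨L * K, fun f hf => ?_⟩
  obtain ⟨hH, g, hg, hlim, hle, hosc⟩ := hK f hf
  have hbd := boundary_ae_eq hlim
  have hn : norm p η g ≤ ((L * K : ℝ≥0) : ℝ≥0∞) * norm p η f := by
    refine (norm_le_of_dyadicBall hp.le hη hg hle hosc).trans (le_of_eq ?_)
    rw [← hL]; push_cast; ring
  have hgC : MemCampanato p η g := memCampanato_of_norm_lt_top hg.aestronglyMeasurable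
    (hn.trans_lt (ENNReal.mul_lt_top ENNReal.coe_lt_top hf.norm_lt_top))
  refine ⟨⟨hH, hlim.mono fun t ht => ⟨_, ht⟩, hgC.congr_ae hbd.symm⟩, ?_⟩
  rwa [norm_congr_ae hbd]

/-- The conjugate operator is bounded on the Campanato space. -/
theorem exists_norm_boundary_conjugate_le {p η : ℝ} (hp : 1 < p) (hη : 0 < η) (hη2 : η < 2) :
    ∃ C : ℝ≥0, ∀ f : T → ℂ, MemCampanato p η f →
      HasRadialLimits (conjugate f) ∧ MemCampanato p η (boundary (conjugate f)) ∧
        norm p η (boundary (conjugate f)) ≤ C * norm p η f := by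
  obtain ⟨K, hK⟩ := exists_szego_oscillation_le hp hη2
  obtain ⟨L, hL⟩ := exists_coe_eq_one_add_two_mul_rpow (η / p)
  have hp0 : 0 < p := by linarith
  have hp1 : (1 : ℝ≥0∞) ≤ ENNReal.ofReal p := by simpa using hp.le
  -- 2K comes from 2g, and the 2 from f and its mean; L converts dyadic oscillation bounds into the
  -- full norm.
  refine ⟨L * (2 * K + 2), fun f hf => ?_⟩
  obtain ⟨-, g, hg, hlim, hle, hosc⟩ := hK f hf
  have hfi := MemLp.integrable_of_one_le hp.le hf.1
  set a := ∫ t, f t ∂σ with ha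
  have hrep : ∀ z, ‖z‖ < 1 →
      conjugate f z = -Complex.I * (2 * szego f z - a - poissonIntegral f z) := by
    intro z hz
    rw [two_mul_szego_sub hfi hz, add_sub_cancel_left, ← mul_assoc]
    simp
  -- The boundary value of the conjugate function, with f as the radial limit of its Poisson
  -- integral by Fatou's theorem.
  set k : T → ℂ := fun t => -Complex.I * (2 * g t - a - f t) with hk
  have hlimk : ∀ᵐ t ∂σ, Tendsto (fun r : ℝ => conjugate f (r * pt t)) (𝓝[<] 1) (𝓝 (k t)) := by
    filter_upwards [hlim, ae_tendsto_poissonIntegral hfi] with t h1 h2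
    refine ((((h1.const_mul 2).sub_const a).sub h2).const_mul (-Complex.I)).congr' ?_
    filter_upwards [eventually_mem_Ioo_zero_one] with r hr
    rw [hrep]
    rw [norm_ofReal_mul_pt hr.1.le]; exact hr.2
  have hbd := boundary_ae_eq hlimk
  have hfn : eLpNorm f (ENNReal.ofReal p) σ ≤ norm p η f := le_self_add
  have hsn : seminorm p η f ≤ norm p η f := le_add_self
  have hI : ‖-Complex.I‖ₑ = 1 := by rw [← ofReal_norm]; simp
  have h2 : ‖(2 : ℂ)‖ₑ = 2 := by rw [← ofReal_norm]; simp
  -- the same linear combination, for any constants and over any piece of the circle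
  have hcomb : ∀ (μ : Measure T) (c d : ℂ), μ ≤ σ →
      eLpNorm (fun t => -Complex.I * (2 * (g t - c) - (f t - d))) (ENNReal.ofReal p) μ
        ≤ 2 * eLpNorm (fun t => g t - c) (ENNReal.ofReal p) μ
          + eLpNorm (fun t => f t - d) (ENNReal.ofReal p) μ := by
    intro μ c d hμ
    have e : (fun t => -Complex.I * (2 * (g t - c) - (f t - d)))
        = (-Complex.I) • ((2 : ℂ) • (fun t => g t - c) - fun t => f t - d) := rfl
    have m1 : AEStronglyMeasurable (fun t => g t - c) μ :=
      (hg.aestronglyMeasurable.mono_measure hμ).sub aestronglyMeasurable_const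
    have m2 : AEStronglyMeasurable (fun t => f t - d) μ :=
      (hf.1.aestronglyMeasurable.mono_measure hμ).sub aestronglyMeasurable_const
    rw [e, eLpNorm_const_smul, hI, one_mul]
    refine (eLpNorm_sub_le (m1.const_smul _) m2 hp1).trans ?_
    rw [eLpNorm_const_smul, h2]
  have hkm : MemLp k (ENNReal.ofReal p) σ :=
    (((hg.const_mul 2).sub (memLp_const a)).sub hf.1).const_mul _
  have hkn : eLpNorm k (ENNReal.ofReal p) σ
      ≤ ((2 * K + 2 : ℝ≥0) : ℝ≥0∞) * norm p η f := by
    have h := hcomb σ 0 (-a) le_rfl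
    have e : k = fun t => -Complex.I * (2 * (g t - 0) - (f t - -a)) := by
      funext t; rw [hk]; ring
    rw [e]
    refine h.trans ?_
    have h4 : eLpNorm (fun t => f t - -a) (ENNReal.ofReal p) σ
        ≤ norm p η f + norm p η f := by
      refine (eLpNorm_sub_le hf.1.aestronglyMeasurable aestronglyMeasurable_const hp1).trans ?_
      refine add_le_add hfn (le_trans ?_ hfn)
      rw [eLpNorm_const _ (by simpa using hp0) (NeZero.ne _)]
      simpa using enorm_integral_le_eLpNorm hp.le hf.1.aestronglyMeasurable
    simp only [sub_zero]
    calc _ ≤ 2 * (K * norm p η f) + (norm p η f + norm p η f) := by gcongr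
      _ = _ := by push_cast; ring
  have hkosc : ∀ (x : T) (n : ℕ), ∃ c : ℂ, eLpNorm (fun t => k t - c) (ENNReal.ofReal p)
      (σ.restrict (dyadicBall x n))
        ≤ (((2 * K + 2 : ℝ≥0) : ℝ≥0∞) * norm p η f) * (2⁻¹ ^ n) ^ (η / p) := by
    intro x n
    obtain ⟨c, hc⟩ := hosc x n
    set d := mean f (dyadicBall x n)
    refine ⟨-Complex.I * (2 * c - a - d), ?_⟩
    have h := hcomb (σ.restrict (dyadicBall x n)) c d Measure.restrict_le_self
    have e : (fun t => k t - -Complex.I * (2 * c - a - d))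
        = fun t => -Complex.I * (2 * (g t - c) - (f t - d)) := by
      funext t; rw [hk]; ring
    rw [e]
    refine h.trans ?_
    have h5 := eLpNorm_sub_mean_dyadicBall_le (η := η) hp0 f x n
    calc _ ≤ 2 * ((K * norm p η f) * (2⁻¹ ^ n) ^ (η / p))
          + norm p η f * (2⁻¹ ^ n) ^ (η / p) := by
          gcongr
          exact h5.trans (by gcongr)
      _ = ((2 * K + 1 : ℝ≥0) : ℝ≥0∞) * norm p η f * (2⁻¹ ^ n) ^ (η / p) := by push_cast; ring
      _ ≤ _ := by
          gcongr
          norm_num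
  have hn : norm p η k ≤ ((L * (2 * K + 2) : ℝ≥0) : ℝ≥0∞) * norm p η f := by
    refine (norm_le_of_dyadicBall hp.le hη hkm hkn hkosc).trans (le_of_eq ?_)
    rw [← hL]; push_cast; ring
  have hkC : MemCampanato p η k := memCampanato_of_norm_lt_top hkm.aestronglyMeasurable
    (hn.trans_lt (ENNReal.mul_lt_top ENNReal.coe_lt_top hf.norm_lt_top))
  refine ⟨hlimk.mono fun t ht => ⟨_, ht⟩, hkC.congr_ae hbd.symm, ?_⟩
  rwa [norm_congr_ae hbd]

/-! ### Surjectivity: recovering a Hardy function from its boundary values -/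

/-- Hölder gains the factor σ(s)^(1 - 1/p) on a small set s, a positive power because p > 1. This is
the hypothesis of Vitali's theorem. -/
theorem unifIntegrable_one_of_eLpNorm_le {p : ℝ} (hp : 1 < p) {F : ℕ → T → ℂ}
    (hF : ∀ n, AEStronglyMeasurable (F n) σ) {M : ℝ≥0∞} (hM : M ≠ ∞)
    (h : ∀ n, eLpNorm (F n) (ENNReal.ofReal p) σ ≤ M) : UnifIntegrable F 1 σ := by
  have hp0 : 0 < p := by linarith
  have hs : 0 < 1 - 1 / p := by rw [sub_pos, div_lt_one hp0]; exact hp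
  intro ε hε
  have hlim : Tendsto (fun δ : ℝ => M * ENNReal.ofReal δ ^ (1 - 1 / p)) (𝓝[>] 0) (𝓝 0) := by
    have h1 : Tendsto (fun δ : ℝ => ENNReal.ofReal δ ^ (1 - 1 / p)) (𝓝[>] 0) (𝓝 0) := by
      have h2 := ((ENNReal.continuous_rpow_const (y := 1 - 1 / p)).comp
        ENNReal.continuous_ofReal).tendsto 0
      simp only [Function.comp_apply, ENNReal.ofReal_zero, ENNReal.zero_rpow_of_pos hs] at h2
      exact h2.mono_left nhdsWithin_le_nhds
    simpa using ENNReal.Tendsto.const_mul h1 (Or.inr hM)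
  have hev := hlim.eventually (gt_mem_nhds (ENNReal.ofReal_pos.2 hε))
  obtain ⟨δ, hδ, hδ0⟩ := (hev.and self_mem_nhdsWithin).exists
  refine ⟨δ, hδ0, fun n s hsm hs' => ?_⟩
  rw [eLpNorm_indicator_eq_eLpNorm_restrict hsm]
  refine (eLpNorm_le_eLpNorm_mul_rpow_measure_univ (q := ENNReal.ofReal p) (by simpa using hp.le)
    (hF n).restrict).trans ?_
  rw [Measure.restrict_apply_univ, ENNReal.toReal_one, ENNReal.toReal_ofReal hp0.le, div_one]
  refine le_trans ?_ hδ.le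
  gcongr
  exact (eLpNorm_mono_measure _ Measure.restrict_le_self).trans (h n)

/-- A function of the Hardy space `H^p`, `p > 1`, with radial limits is the Szegő projection of its
boundary function. -/
theorem szego_boundary_eq {p : ℝ} (hp : 1 < p) {F : ℂ → ℂ} (hF : MemHardy p F)
    (hlim : HasRadialLimits F) (hb : MemLp (boundary F) (ENNReal.ofReal p) σ) {z : ℂ}
    (hz : ‖z‖ < 1) : szego (boundary F) z = F z := by
  -- The shift by one avoids radius 0, which the Hardy supremum over the open interval does not
  -- cover.
  set ρ : ℕ → ℝ := fun n => 1 - 1 / (((n + 1 : ℕ) : ℝ) + 1) with hρ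
  have hρ0 : ∀ n, 0 < ρ n := fun n => by
    rw [hρ]
    simp only [sub_pos]
    rw [div_lt_one (by positivity)]
    push_cast
    linarith [n.cast_nonneg (α := ℝ)]
  have hρ1 : ∀ n, ρ n < 1 := fun n => one_sub_one_div_lt_one (n + 1)
  have hρt : Tendsto ρ atTop (𝓝[<] 1) := tendsto_one_sub_one_div.comp (tendsto_add_atTop_nat 1)
  have hcont : ∀ n, Continuous fun t => F (ρ n * pt t) := fun n =>
    hF.1.continuousOn.comp_continuous (by fun_prop)
      fun t => mul_pt_mem_ball (hρ0 n).le (hρ1 n) t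
  have hbi := MemLp.integrable_of_one_le hp.le hb
  have hUI : UnifIntegrable (fun n t => F (ρ n * pt t)) 1 σ := by
    refine unifIntegrable_one_of_eLpNorm_le hp (fun n => (hcont n).aestronglyMeasurable) hF.2.ne
      fun n => ?_
    exact le_iSup (fun r : Set.Ioo (0 : ℝ) 1 =>
      eLpNorm (fun t : T => F ((r : ℝ) * pt t)) (ENNReal.ofReal p) σ) ⟨ρ n, hρ0 n, hρ1 n⟩
  have hae : ∀ᵐ t ∂σ, Tendsto (fun n => F (ρ n * pt t)) atTop (𝓝 (boundary F t)) := by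
    filter_upwards [hlim] with t ht
    exact (tendsto_nhds_limUnder ht).comp hρt
  -- Vitali: almost everywhere radial convergence and uniform integrability give convergence of the
  -- dilates in `L¹`.
  have hL1 := tendsto_Lp_finite_of_tendsto_ae (μ := σ) le_rfl ENNReal.one_ne_top
    (fun n => (hcont n).aestronglyMeasurable) (memLp_one_iff_integrable.2 hbi) hUI hae
  obtain ⟨M, hM⟩ := isCompact_univ.exists_bound_of_continuousOn
    (continuous_inv_one_sub hz).continuousOn
  have hS : Tendsto (fun n => szego (fun t => F (ρ n * pt t)) z) atTop
      (𝓝 (szego (boundary F) z)) := by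
    rw [tendsto_iff_edist_tendsto_0]
    refine tendsto_of_tendsto_of_tendsto_of_le_of_le tendsto_const_nhds
      (h := fun n => ENNReal.ofReal M * eLpNorm ((fun t => F (ρ n * pt t)) - boundary F) 1 σ) ?_
      (fun n => zero_le) fun n => ?_
    · simpa using ENNReal.Tendsto.const_mul hL1 (Or.inr ENNReal.ofReal_ne_top)
    · beta_reduce
      have hi : Integrable (fun t => F (ρ n * pt t)) σ :=
        memLp_one_iff_integrable.1 (memLp_of_continuous (hcont n) 1)
      rw [edist_eq_enorm_sub, ← szego_sub hi hbi hz, szego, eLpNorm_one_eq_lintegral_enorm,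
        ← lintegral_const_mul' _ _ ENNReal.ofReal_ne_top]
      refine (enorm_integral_le_lintegral_enorm _).trans (lintegral_mono fun t => ?_)
      rw [div_eq_mul_inv, enorm_mul, mul_comm, ← ofReal_norm (_⁻¹)]
      gcongr
      · exact hM t trivial
      · rfl
  refine tendsto_nhds_unique hS
    -- Each dilate extends holomorphically past the circle, so Cauchy's formula reproduces it; both
    -- sides pass to the limit.
    (((tendsto_dilate hF.1 hz).comp (tendsto_add_atTop_nat 1)).congr fun n => ?_)
  exact (szego_of_diffContOnCl (diffContOnCl_dilate hF.1 (hρ0 n).le (hρ1 n)) hz).symm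

end Campanato

theorem mainTheorem4 (p η : ℝ) (hη : 0 < η) (hη2 : η < 2) (hp : 2 < 1 + p) :
    -- the Szegő projection maps the Campanato space boundedly into the analytic one
    (∃ C : NNReal, ∀ f : Campanato.T → ℂ, Campanato.MemCampanato p η f →
      Campanato.MemAnalyticCampanato p η (Campanato.szego f) ∧
      Campanato.norm p η (Campanato.boundary (Campanato.szego f))
        ≤ C * Campanato.norm p η f) ∧
    -- and onto it
    (∀ F : ℂ → ℂ, Campanato.MemAnalyticCampanato p η F →
      ∃ f : Campanato.T → ℂ, Campanato.MemCampanato p η f ∧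
        Set.EqOn (Campanato.szego f) F (Metric.ball 0 1)) ∧
    -- the conjugate operator is bounded on the Campanato space
    (∃ C : NNReal, ∀ f : Campanato.T → ℂ, Campanato.MemCampanato p η f →
      Campanato.HasRadialLimits (Campanato.conjugate f) ∧
      Campanato.MemCampanato p η (Campanato.boundary (Campanato.conjugate f)) ∧
      Campanato.norm p η (Campanato.boundary (Campanato.conjugate f))
        ≤ C * Campanato.norm p η f) := by
  have hp1 : 1 < p := by linarith
  refine ⟨Campanato.exists_norm_boundary_szego_le hp1 hη hη2, fun F hF => ?_,
    Campanato.exists_norm_boundary_conjugate_le hp1 hη hη2⟩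
  refine ⟨Campanato.boundary F, hF.2.2, fun z hz => ?_⟩
  exact Campanato.szego_boundary_eq hp1 hF.1 hF.2.1 hF.2.2.1 (by simpa using hz)
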